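/- For a graph $G$ and a graph $T$ let $\mathcal N(T,G)$ denote the number of (not necessarily induced) subgraphs of $G$ isomorphic to $T$, let $P_\ell$ denote the path with $\ell$ edges, and let $\mathrm{ex}(n,T,H)$ denote the maximum of $\mathcal N(T,G)$ over all $n$-vertex graphs $G$ that contain no (not necessarily induced) copy of $H$. For $k\ge 5$ put $t=\lfloor (k-1)/2\rfloor$, and for $n\ge k$ let $G_{n,k,t}$ be the $n$-vertex graph whose vertex set is partitioned into classes $A,B,C$ with $|A|=t$, $|B|=n-k+t$, $|C|=k-2t$, in which $A\cup C$ is a clique, $B$ is an independent set, all pairs between $A$ and $B$ are edges, and there are no edges between $B$ and $C$. Theorem. For every integer $k\ge 5$ there exists $n_1\in\mathbb N$ such that for all $n\ge n_1$ $$\mathrm{ex}(n,P_4,P_k)=\mathcal N(P_4,G_{n,k,t}),$$ and, as $n\to\infty$ with $k$ fixed, $$\mathrm{ex}(n,P_4,P_k)=\frac{t(t-1)}{2}\,n^3+O(n^2).$$ Moreover, for all $n\ge n_1$: if $k\ge 6$, then $G_{n,k,t}$ is, up to isomorphism, the only $n$-vertex $P_k$-free graph with $\mathrm{ex}(n,P_4,P_k)$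 copies of $P_4$; if $k=5$ (so $t=2$), there are, up to isomorphism, exactly two such graphs, $G_{n,5,2}$ and the complete bipartite graph $K_{2,n-2}$. -/

import Mathlib

open Filter Asymptotics

/-- The path with `ℓ` edges, that is, on `ℓ + 1` vertices. -/
def edgePath (ℓ : ℕ) : SimpleGraph (Fin (ℓ + 1)) :=
  SimpleGraph.pathGraph (ℓ + 1)

open scoped Classical in
/-- The generalized extremal number: the maximum number of (not necessarily induced, unlabelled)
copies of `T` in an `H`-free graph on `n` vertices. -/
noncomputable def genExtremalNumber (n : ℕ) {U W : Type*}
    (T : SimpleGraph U) (H : SimpleGraph W) : ℕ :=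
  Finset.sup {G : SimpleGraph (Fin n) | H.Free G} (fun G => G.copyCount T)

/-- `G` is an `H`-free graph on `n` labelled vertices with the maximum number of copies of `T`. -/
def IsGenExtremal {n : ℕ} {U W : Type*} (T : SimpleGraph U) (H : SimpleGraph W)
    (G : SimpleGraph (Fin n)) : Prop :=
  H.Free G ∧ G.copyCount T = genExtremalNumber n T H

/-- The graph `G_{n,k,a}` (for `2 * a ≤ k` and `k ≤ n + a`). The vertex set is partitioned into
`A = {i | i < a}`, `C = {i | a ≤ i < k - a}` and `B = {i | k - a ≤ i < n}`, of sizes `a`,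
`k - 2 * a` and `n - k + a`. The set `A ∪ C` is a clique, `B` is independent, all pairs between
`A` and `B` are edges, and there are no edges between `B` and `C`. -/
def kopylovGraph (n k a : ℕ) : SimpleGraph (Fin n) where
  Adj i j := i ≠ j ∧ (i.val < a ∨ j.val < a ∨ (i.val < k - a ∧ j.val < k - a))
  symm := ⟨fun _ _ h => ⟨h.1.symm, by tauto⟩⟩
  loopless := ⟨fun _ h => h.1 rfl⟩

/-! Paths are counted as ordered quintuples `(a, b, c, d, e)`, two per copy. A `P_k`-free graph has
only `O(n)` edges, so quintuples in which `b` or `d` has degree below `n / M` number at most a small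
multiple of `n ^ 3`, and all other `b`, `d` lie in a set `H` of bounded size. Only boundedly many
`c` have more than `t` neighbours in `H`, since `t + 1` vertices with many common neighbours already
carry a `P_k`. Any other `c` admits at most `t * (t - 1) * n ^ 2` quintuples, and noticeably fewer
unless `t` vertices have almost full degree. As `kopylovGraph` reaches `t * (t - 1) * n ^ 3 - O(n ^
2)`, an extremal graph has a set `A` of `t` vertices of almost full degree
(`exists_core_of_card_fivePaths`), whose common neighbourhood `B` is almost everything.

Exactness comes from surgery. Giving the vertices of a set `D` the neighbourhood `A` keeps the graph
`P_k`-free and creates about `n ^ 2` new quintuples per vertex of `D`, so in an extremal graph it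
must destroy at least as many (`card_le_of_replaceNeighbors`). This makes the graph connected and,
together with paths that alternate between `A` and `B`, leaves at most one edge outside `A`, and
none for odd `k` (`edges_of_maximal`). An extremal graph is therefore a subgraph of `kopylovGraph`
up to isomorphism. Every edge of `kopylovGraph` lies on a four-edge path, except the edge inside `A`
when `k = 5`; this gives uniqueness and the single exception. -/

namespace SimpleGraph

/-! ### Labelled four-edge paths versus unlabelled copies -/

section Counting

open scoped Classical

variable {V : Type*} [Fintype V]

/-- The quintuple of vertices `x` traces a path with four edges. -/
def IsFivePath (G : SimpleGraph V) (x : V × V × V × V × V) : Prop :=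
  (G.Adj x.1 x.2.1 ∧ G.Adj x.2.1 x.2.2.1 ∧ G.Adj x.2.2.1 x.2.2.2.1 ∧
    G.Adj x.2.2.2.1 x.2.2.2.2) ∧
  [x.1, x.2.1, x.2.2.1, x.2.2.2.1, x.2.2.2.2].Nodup

/-- The set of labelled paths with four edges. -/
noncomputable def fivePaths (G : SimpleGraph V) : Finset (V × V × V × V × V) :=
  Finset.univ.filter G.IsFivePath

lemma mem_fivePaths {G : SimpleGraph V} {a b c d e : V} :
    (a, b, c, d, e) ∈ G.fivePaths ↔
      (G.Adj a b ∧ G.Adj b c ∧ G.Adj c d ∧ G.Adj d e) ∧ [a, b, c, d, e].Nodup := by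
  simp [fivePaths, IsFivePath]

lemma fivePaths_mono {G H : SimpleGraph V} (h : G ≤ H) : G.fivePaths ⊆ H.fivePaths := by
  rintro ⟨a, b, c, d, e⟩ hx
  rw [mem_fivePaths] at hx ⊢
  exact ⟨⟨h hx.1.1, h hx.1.2.1, h hx.1.2.2.1, h hx.1.2.2.2⟩, hx.2⟩

/-- Labelled paths with four edges are the copies of `edgePath 4`. -/
noncomputable def copyEquivFivePaths (G : SimpleGraph V) :
    Copy (edgePath 4) G ≃ G.fivePaths where
  toFun f := ⟨(f 0, f 1, f 2, f 3, f 4), by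
    have hadj : ∀ i j : Fin 5, i.val + 1 = j.val → G.Adj (f i) (f j) := fun i j h =>
      f.toHom.map_adj (pathGraph_adj.2 (Or.inl h))
    have hne : ∀ i j : Fin 5, i ≠ j → f i ≠ f j := fun i j h h' => h (f.injective h')
    rw [mem_fivePaths]
    refine ⟨⟨hadj 0 1 rfl, hadj 1 2 rfl, hadj 2 3 rfl, hadj 3 4 rfl⟩, ?_⟩
    simp [hne]⟩
  invFun x := ⟨⟨![x.1.1, x.1.2.1, x.1.2.2.1, x.1.2.2.2.1, x.1.2.2.2.2], by
      obtain ⟨⟨a, b, c, d, e⟩, hx⟩ := x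
      rw [mem_fivePaths] at hx
      obtain ⟨⟨h1, h2, h3, h4⟩, -⟩ := hx
      intro i j hij
      rw [edgePath, pathGraph_adj] at hij
      fin_cases i <;> fin_cases j <;> simp at hij <;>
        simp [h1, h2, h3, h4, h1.symm, h2.symm, h3.symm, h4.symm]⟩, by
      obtain ⟨⟨a, b, c, d, e⟩, hx⟩ := x
      rw [mem_fivePaths] at hx
      obtain ⟨-, hn⟩ := hx
      simp at hn
      intro i j hij
      fin_cases i <;> fin_cases j <;> simp at hij ⊢ <;> grind⟩
  left_inv f := by
    ext i
    fin_cases i <;> rfl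
  right_inv x := rfl

/-- Reversal of the copies of a path. -/
def Copy.reversePath {G : SimpleGraph V} (f : Copy (edgePath 4) G) : Copy (edgePath 4) G :=
  ⟨⟨fun i => f (Fin.rev i), fun {i j} h => f.toHom.map_adj (by
      rw [edgePath, pathGraph_adj] at h ⊢
      simp only [Fin.val_rev]; omega)⟩, f.injective.comp Fin.rev_injective⟩

lemma Copy.reversePath_ne {V : Type*} {G : SimpleGraph V} (f : Copy (edgePath 4) G) :
    f.reversePath ≠ f := by
  intro h
  have : f (Fin.rev 0) = f 0 := congrArg (fun g : Copy (edgePath 4) G => g 0) h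
  exact absurd (f.injective this) (by decide)

lemma Copy.reversePath_toSubgraph {V : Type*} {G : SimpleGraph V} (f : Copy (edgePath 4) G) :
    f.reversePath.toSubgraph = f.toSubgraph := by
  have key : ∀ g : Copy (edgePath 4) G, g.reversePath.toSubgraph ≤ g.toSubgraph := by
    intro g
    refine ⟨?_, ?_⟩
    · rintro _ ⟨i, -, rfl⟩
      exact ⟨Fin.rev i, trivial, rfl⟩
    · rintro _ _ ⟨i, j, h, rfl, rfl⟩
      refine ⟨Fin.rev i, Fin.rev j, ?_, rfl, rfl⟩
      rw [Subgraph.top_adj, edgePath, pathGraph_adj] at h ⊢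
      simp only [Fin.val_rev]; omega
  refine le_antisymm (key f) ?_
  have h := key f.reversePath
  have h2 : f.reversePath.reversePath = f := by
    ext i
    exact congrArg f (Fin.rev_rev i)
  rwa [h2] at h

/-- Both copies have the same vertices, so `g = f ∘ σ`. Here `σ` moves along `0, …, 4` in unit steps
without turning back, which leaves only the identity and the reversal. -/
lemma Copy.eq_or_eq_reversePath {V : Type*} {G : SimpleGraph V} {f g : Copy (edgePath 4) G}
    (h : g.toSubgraph = f.toSubgraph) : g = f ∨ g = f.reversePath := by
  have hv : ∀ i, ∃ j, f j = g i := by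
    intro i
    have : g i ∈ g.toSubgraph.verts := ⟨i, trivial, rfl⟩
    rw [h] at this
    obtain ⟨j, -, hj⟩ := this
    exact ⟨j, hj⟩
  choose σ hσ using hv
  have hadj : ∀ i j : Fin 5, i.val + 1 = j.val →
      (σ i).val + 1 = (σ j).val ∨ (σ j).val + 1 = (σ i).val := by
    intro i j hij
    have : g.toSubgraph.Adj (g i) (g j) :=
      ⟨i, j, pathGraph_adj.2 (Or.inl hij), rfl, rfl⟩
    rw [h] at this
    obtain ⟨i', j', h', hi, hj⟩ := this
    have hi' : i' = σ i := f.injective (hi.trans (hσ i).symm)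
    have hj' : j' = σ j := f.injective (hj.trans (hσ j).symm)
    subst hi' hj'
    exact pathGraph_adj.1 h'
  have hinj : ∀ i j : Fin 5, i ≠ j → (σ i).val ≠ (σ j).val := by
    intro i j hij he
    exact hij (g.injective (((hσ i).symm.trans (congrArg f (Fin.ext he))).trans (hσ j)))
  have a0 := hadj 0 1 rfl
  have a1 := hadj 1 2 rfl
  have a2 := hadj 2 3 rfl
  have a3 := hadj 3 4 rfl
  have i0 := hinj 0 2 (by decide)
  have i1 := hinj 1 3 (by decide)
  have i2 := hinj 2 4 (by decide)
  have b0 := (σ 0).isLt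
  have b1 := (σ 1).isLt
  have b2 := (σ 2).isLt
  have b3 := (σ 3).isLt
  have b4 := (σ 4).isLt
  have : ((σ 0).val = 0 ∧ (σ 1).val = 1 ∧ (σ 2).val = 2 ∧ (σ 3).val = 3 ∧ (σ 4).val = 4) ∨
      ((σ 0).val = 4 ∧ (σ 1).val = 3 ∧ (σ 2).val = 2 ∧ (σ 3).val = 1 ∧ (σ 4).val = 0) := by
    omega
  rcases this with ⟨h0, h1, h2, h3, h4⟩ | ⟨h0, h1, h2, h3, h4⟩
  · left
    ext i
    rw [← hσ i]
    congr 1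
    fin_cases i <;> apply Fin.ext <;> assumption
  · right
    ext i
    rw [← hσ i]
    change f (σ i) = f (Fin.rev i)
    congr 1
    fin_cases i <;> apply Fin.ext <;> assumption

/-- Each subgraph copy is traced by exactly two labelled paths, one for each direction. -/
lemma card_fivePaths (G : SimpleGraph V) :
    G.fivePaths.card = 2 * G.copyCount (edgePath 4) := by
  have h1 : G.fivePaths.card = (Finset.univ : Finset (Copy (edgePath 4) G)).card := by
    rw [Finset.card_univ, Fintype.card_congr G.copyEquivFivePaths, Fintype.card_coe]
  rw [h1, copyCount_eq_card_image_copyToSubgraph, mul_comm]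
  rw [Finset.card_eq_sum_card_image Copy.toSubgraph, Finset.sum_const_nat]
  intro x hx
  obtain ⟨f, -, rfl⟩ := Finset.mem_image.1 hx
  have : Finset.univ.filter (fun g : Copy (edgePath 4) G => g.toSubgraph = f.toSubgraph)
      = {f, f.reversePath} := by
    ext g
    simp only [Finset.mem_filter, Finset.mem_univ, true_and, Finset.mem_insert,
      Finset.mem_singleton]
    refine ⟨Copy.eq_or_eq_reversePath, ?_⟩
    rintro (rfl | rfl)
    · rfl
    · exact f.reversePath_toSubgraph
  rw [this, Finset.card_pair f.reversePath_ne.symm]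

lemma card_fivePaths_congr {W : Type*} [Fintype W] {G : SimpleGraph V} {H : SimpleGraph W}
    (φ : G ≃g H) : G.fivePaths.card = H.fivePaths.card := by
  rw [← Fintype.card_coe, ← Fintype.card_coe, ← Fintype.card_congr G.copyEquivFivePaths,
    ← Fintype.card_congr H.copyEquivFivePaths]
  refine Fintype.card_congr ⟨fun f => φ.toCopy.comp f, fun f => φ.symm.toCopy.comp f, ?_, ?_⟩
  · intro f; ext i; simp
  · intro f; ext i; simp

end Counting

/-! ### Path building, sparsity and neighbourhood replacement -/

section Paths

open scoped Classical

lemma edgePath_isContained_of_isChain {V : Type*} {G : SimpleGraph V} {k : ℕ} {l : List V}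
    (hc : l.IsChain G.Adj) (hn : l.Nodup) (hl : k + 1 ≤ l.length) : edgePath k ⊑ G := by
  have hadj : ∀ i j : Fin (k + 1), i.val + 1 = j.val →
      G.Adj (l[i.val]'(by omega)) (l[j.val]'(by omega)) := by
    intro i j hij
    have := (List.isChain_iff_getElem.1 hc) i.val (by omega)
    simpa [hij] using this
  refine ⟨⟨⟨fun i => l[i.val]'(by omega), ?_⟩, ?_⟩⟩
  · intro i j h
    rcases pathGraph_adj.1 h with h | h
    · exact hadj i j h
    · exact (hadj j i h).symm
  · intro i j hij
    exact Fin.ext ((hn.getElem_inj_iff).1 hij)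

/-- A path that alternates between a prescribed list `a :: as` and a large set `B` of common
neighbours, and continues with a prescribed tail. -/
lemma exists_alternating_path {V : Type*} {G : SimpleGraph V} (B X : Finset V) (tail : List V)
    (htail : ∀ b ∈ B, (b :: tail).IsChain G.Adj) (hX' : ∀ x ∈ tail, x ∈ X) :
    ∀ (as : List V) (a : V), (∀ x ∈ a :: as, ∀ b ∈ B, G.Adj x b) → (∀ x ∈ a :: as, x ∈ X) →
      (a :: as ++ tail).Nodup → X.card + (2 * as.length + tail.length + 1) < B.card →
      ∃ l : List V, (a :: l).IsChain G.Adj ∧ (a :: l).Nodup ∧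
        l.length = 2 * as.length + 1 + tail.length ∧
        ∀ x ∈ l, x ∈ as ∨ x ∈ tail ∨ (x ∈ B ∧ x ∉ X) := by
  intro as
  induction as with
  | nil =>
    intro a hB hX hn hcard
    obtain ⟨b, hb, hbX⟩ := Finset.exists_mem_notMem_of_card_lt_card (by omega : X.card < B.card)
    refine ⟨b :: tail, ?_, ?_, by simp; omega, ?_⟩
    · exact List.isChain_cons_cons.2 ⟨hB a (by simp) b hb, htail b hb⟩
    · have h1 : a ∈ X := hX a (by simp)
      have h2 : b ∉ tail := fun h => hbX (hX' b h)
      have h3 : a ≠ b := fun h => hbX (h ▸ h1)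
      simp at hn ⊢
      tauto
    · intro x hx
      rcases List.mem_cons.1 hx with rfl | hx
      · exact Or.inr (Or.inr ⟨hb, hbX⟩)
      · exact Or.inr (Or.inl hx)
  | cons a₂ as ih =>
    intro a hB hX hn hcard
    obtain ⟨l, hc, hnl, hlen, hmem⟩ := ih a₂ (fun x hx => hB x (by simp at hx ⊢; tauto))
      (fun x hx => hX x (by simp at hx ⊢; tauto)) (List.nodup_cons.1 hn).2
      (by simp at hcard; omega)
    have hlt : (X ∪ l.toFinset).card < B.card := by
      have h1 := Finset.card_union_le X l.toFinset
      have h2 := List.toFinset_card_le l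
      simp at hcard
      omega
    obtain ⟨b, hb, hbX⟩ := Finset.exists_mem_notMem_of_card_lt_card hlt
    have ha : a ∈ X := hX a (by simp)
    have ha₂ : a₂ ∈ X := hX a₂ (by simp)
    simp only [Finset.mem_union, List.mem_toFinset, not_or] at hbX
    refine ⟨b :: a₂ :: l, ?_, ?_, by simp; omega, ?_⟩
    · refine List.isChain_cons_cons.2 ⟨hB a (by simp) b hb, List.isChain_cons_cons.2 ⟨?_, hc⟩⟩
      exact (hB a₂ (by simp) b hb).symm
    · have h1 : a ≠ b := fun h => hbX.1 (h ▸ ha)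
      have h2 : b ≠ a₂ := fun h => hbX.1 (h ▸ ha₂)
      have h3 : a ∉ l := by
        intro h
        rcases hmem a h with h | h | h
        · simp at hn; tauto
        · simp at hn; tauto
        · exact h.2 ha
      have h4 : a ≠ a₂ := by
        rintro rfl
        simp at hn
      rw [List.nodup_cons, List.nodup_cons]
      simp only [List.mem_cons, not_or]
      exact ⟨⟨h1, h4, h3⟩, ⟨h2, hbX.2⟩, hnl⟩
    · intro x hx
      simp only [List.mem_cons] at hx ⊢
      rcases hx with rfl | rfl | hx
      · exact Or.inr (Or.inr ⟨hb, hbX.1⟩)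
      · exact Or.inl (Or.inl rfl)
      · rcases hmem x hx with h | h
        · exact Or.inl (Or.inr h)
        · exact Or.inr h

/-- The neighbours of `v` in the finite set `S`. -/
noncomputable def neighborsIn {V : Type*} (G : SimpleGraph V) (S : Finset V) (v : V) : Finset V :=
  S.filter (G.Adj v)

@[simp] lemma mem_neighborsIn {V : Type*} {G : SimpleGraph V} {S : Finset V} {v w : V} :
    w ∈ G.neighborsIn S v ↔ w ∈ S ∧ G.Adj v w := by
  simp [neighborsIn]

/-- The oriented edges inside `S`. -/
noncomputable def dartsIn {V : Type*} (G : SimpleGraph V) (S : Finset V) : Finset (V × V) :=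
  (S ×ˢ S).filter fun p => G.Adj p.1 p.2

@[simp] lemma mem_dartsIn {V : Type*} {G : SimpleGraph V} {S : Finset V} {p : V × V} :
    p ∈ G.dartsIn S ↔ (p.1 ∈ S ∧ p.2 ∈ S) ∧ G.Adj p.1 p.2 := by
  simp [dartsIn]

/-- If all degrees inside `S` were at least `k`, a path in `S` could be extended greedily at its
head until it had `k` edges. -/
lemma exists_card_neighborsIn_lt {V : Type*} {G : SimpleGraph V} {k : ℕ}
    (hfree : (edgePath k).Free G) {S : Finset V} (hS : S.Nonempty) :
    ∃ v ∈ S, (G.neighborsIn S v).card < k := by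
  by_contra! hdeg
  have key : ∀ j ≤ k, ∃ (h : V) (l : List V), h ∈ S ∧ (h :: l).IsChain G.Adj ∧ (h :: l).Nodup ∧
      l.length = j := by
    intro j
    induction j with
    | zero =>
      intro _
      obtain ⟨v, hv⟩ := hS
      exact ⟨v, [], hv, by simp, by simp, rfl⟩
    | succ j ih =>
      intro hj
      obtain ⟨h, l, hh, hc, hn, hl⟩ := ih (by omega)
      have hlt : l.toFinset.card < (G.neighborsIn S h).card := by
        have h1 := List.toFinset_card_le l
        have h2 := hdeg h hh
        omega
      obtain ⟨x, hx, hxl⟩ := Finset.exists_mem_notMem_of_card_lt_card hlt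
      rw [mem_neighborsIn] at hx
      refine ⟨x, h :: l, hx.1, List.isChain_cons_cons.2 ⟨hx.2.symm, hc⟩, ?_, by simp [hl]⟩
      refine List.nodup_cons.2 ⟨?_, hn⟩
      have := hx.2.ne'
      simp at hxl ⊢
      tauto
  obtain ⟨h, l, -, hc, hn, hl⟩ := key k le_rfl
  exact hfree (edgePath_isContained_of_isChain hc hn (by simp [hl]))

/-- Degeneracy: deleting a vertex with fewer than `k` neighbours in `S` loses fewer than `2 * k`
oriented edges. -/
lemma card_dartsIn_le {V : Type*} {G : SimpleGraph V} {k : ℕ} (hfree : (edgePath k).Free G)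
    (S : Finset V) : (G.dartsIn S).card ≤ 2 * k * S.card := by
  induction S using Finset.strongInduction with
  | H S ih =>
    rcases S.eq_empty_or_nonempty with rfl | hS
    · simp [dartsIn]
    obtain ⟨v, hv, hlt⟩ := exists_card_neighborsIn_lt hfree hS
    have hsub : G.dartsIn S ⊆ G.dartsIn (S.erase v) ∪
        ((G.neighborsIn S v).image (fun w => (v, w)) ∪
          (G.neighborsIn S v).image (fun w => (w, v))) := by
      rintro ⟨x, y⟩ h
      simp only [mem_dartsIn, Finset.mem_union, Finset.mem_image, mem_neighborsIn,
        Prod.mk.injEq, Finset.mem_erase] at h ⊢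
      by_cases hx : x = v
      · exact Or.inr (Or.inl ⟨y, ⟨h.1.2, hx ▸ h.2⟩, hx.symm, rfl⟩)
      · by_cases hy : y = v
        · exact Or.inr (Or.inr ⟨x, ⟨h.1.1, hy ▸ h.2.symm⟩, rfl, hy.symm⟩)
        · exact Or.inl ⟨⟨⟨hx, h.1.1⟩, hy, h.1.2⟩, h.2⟩
    have h1 := Finset.card_le_card hsub
    have h2 := Finset.card_union_le (G.dartsIn (S.erase v))
      ((G.neighborsIn S v).image (fun w => (v, w)) ∪ (G.neighborsIn S v).image (fun w => (w, v)))
    have h3 := Finset.card_union_le ((G.neighborsIn S v).image (fun w => (v, w)))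
      ((G.neighborsIn S v).image (fun w => (w, v)))
    have h4 := Finset.card_image_le (s := G.neighborsIn S v) (f := fun w => (v, w))
    have h5 := Finset.card_image_le (s := G.neighborsIn S v) (f := fun w => (w, v))
    have h6 := ih _ (Finset.erase_ssubset hv)
    have h7 := Finset.card_erase_add_one hv
    rw [← h7, mul_add]
    omega

/-- The graph obtained from `G` by giving each vertex of `D` the neighbourhood `A`. -/
def replaceNeighbors {V : Type*} (G : SimpleGraph V) (D A : Finset V) : SimpleGraph V where
  Adj u v := (u ∉ D ∧ v ∉ D ∧ G.Adj u v) ∨ (u ∈ D ∧ v ∈ A ∧ v ∉ D) ∨ (u ∈ A ∧ u ∉ D ∧ v ∈ D)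
  symm := ⟨fun u v h => by rw [G.adj_comm]; tauto⟩
  loopless := ⟨fun u h => by have := G.irrefl (v := u); tauto⟩

/-- In a path of the new graph, each vertex of `D` has its path neighbours in `A`. Replacing these
vertices by distinct unused vertices of `B`, which are joined to all of `A`, gives a path of `G`.
The bound on `B` leaves `k + 1` spare vertices. -/
lemma free_replaceNeighbors {V : Type*} {G : SimpleGraph V} {k : ℕ} {A B D : Finset V}
    (hfree : (edgePath k).Free G) (hAB : ∀ a ∈ A, ∀ b ∈ B, G.Adj a b)
    (hcard : 2 * (k + 1) ≤ B.card) : (edgePath k).Free (G.replaceNeighbors D A) := by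
  rintro ⟨f⟩
  have hR : (k + 1) ≤ (B \ Finset.univ.image f).card := by
    have h1 : (Finset.univ.image f).card ≤ k + 1 := Finset.card_image_le.trans (by simp)
    have h2 := Finset.le_card_sdiff (Finset.univ.image f) B
    omega
  obtain ⟨φ⟩ : Nonempty (Fin (k + 1) ↪ (B \ Finset.univ.image f : Finset V)) := by
    apply Function.Embedding.nonempty_of_card_le
    simpa using hR
  have hφB : ∀ i, (φ i : V) ∈ B := fun i => (Finset.mem_sdiff.1 (φ i).2).1
  have hφf : ∀ i j, (φ i : V) ≠ f j := fun i j h =>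
    (Finset.mem_sdiff.1 (φ i).2).2 (h ▸ Finset.mem_image_of_mem f (Finset.mem_univ j))
  refine hfree ⟨⟨⟨fun i => if f i ∈ D then φ i else f i, ?_⟩, ?_⟩⟩
  · intro i j hij
    have h : (G.replaceNeighbors D A).Adj (f i) (f j) := f.toHom.map_adj hij
    rcases h with ⟨hi, hj, h⟩ | ⟨hi, hj, hj'⟩ | ⟨hi, hi', hj⟩
    · simpa [hi, hj] using h
    · simpa [hi, hj'] using (hAB _ hj _ (hφB i)).symm
    · simpa [hi', hj] using hAB _ hi _ (hφB j)
  · intro i j hij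
    change (if f i ∈ D then (φ i : V) else f i) = if f j ∈ D then (φ j : V) else f j at hij
    split_ifs at hij with h1 h2 h2
    · exact φ.injective (Subtype.ext hij)
    · exact absurd hij (hφf i j)
    · exact absurd hij.symm (hφf j i)
    · exact f.injective hij

/-- In a graph with the maximum number of four-edge paths, replacing the neighbourhoods of the
vertices of `D` by `A` destroys at least as many paths as it creates. -/
lemma card_le_of_replaceNeighbors {V : Type*} [Fintype V] {G : SimpleGraph V} {k : ℕ}
    {A B D : Finset V} (hfree : (edgePath k).Free G)
    (hmax : ∀ G' : SimpleGraph V, (edgePath k).Free G' → G'.fivePaths.card ≤ G.fivePaths.card)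
    (hAB : ∀ a ∈ A, ∀ b ∈ B, G.Adj a b) (hcard : 2 * (k + 1) ≤ B.card) (hA : 2 ≤ A.card)
    (hDA : ∀ v ∈ D, v ∉ A) (hD : ∀ v ∈ D, ∃ a ∈ A, ¬ G.Adj a v)
    (T : Finset (V × V × V × V × V))
    (hT : ∀ a b c d e, (a, b, c, d, e) ∈ G.fivePaths → (a, b, c, d, e) ∉ T →
      ∀ p ∈ [(a, b), (b, c), (c, d), (d, e)], (p.1 ∈ D → p.2 ∈ A) ∧ (p.2 ∈ D → p.1 ∈ A)) :
    (B.card * B.card - B.card) * D.card ≤ T.card := by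
  have hBD : ∀ b ∈ B, b ∉ D := fun b hb hbD =>
    let ⟨a, ha, h⟩ := hD b hbD
    h (hAB a ha b hb)
  have h2 : ∀ v, ∃ a, v ∈ D → a ∈ A ∧ ¬ G.Adj a v := fun v => by
    by_cases hv : v ∈ D
    · obtain ⟨a, ha⟩ := hD v hv
      exact ⟨a, fun _ => ha⟩
    · exact ⟨v, fun h => absurd h hv⟩
  choose α hα using h2
  have h1 : ∀ v, ∃ a ∈ A, a ≠ α v := fun v => by
    by_contra! h
    have : A.card ≤ ({α v} : Finset V).card :=
      Finset.card_le_card fun a ha => Finset.mem_singleton.2 (h a ha)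
    simp at this
    omega
  choose β hβA hβ using h1
  -- The created paths are `x, β v, y, α v, v` with `x ≠ y` in `B`. They end in the edge from `α v`
  -- to `v`, which is absent from `G`, so none of them is an old path.
  set N : Finset (V × V × V × V × V) := (B.offDiag ×ˢ D).image
    (fun p => (p.1.1, β p.2, p.1.2, α p.2, p.2)) with hN
  have hNcard : N.card = (B.card * B.card - B.card) * D.card := by
    rw [hN, Finset.card_image_of_injective, Finset.card_product, Finset.offDiag_card]
    rintro ⟨⟨x, y⟩, z⟩ ⟨⟨x', y'⟩, z'⟩ h
    simp only [Prod.mk.injEq] at h ⊢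
    tauto
  have hadj : ∀ u v, G.Adj u v → (u ∈ D → v ∈ A) → (v ∈ D → u ∈ A) →
      (G.replaceNeighbors D A).Adj u v := by
    intro u v h h1 h2
    have := hDA u
    have := hDA v
    simp only [replaceNeighbors]
    tauto
  have hsub : (G.fivePaths \ T) ∪ N ⊆ (G.replaceNeighbors D A).fivePaths := by
    apply Finset.union_subset
    · rintro ⟨a, b, c, d, e⟩ hx
      rw [Finset.mem_sdiff] at hx
      have hg := hT a b c d e hx.1 hx.2
      rw [mem_fivePaths] at hx ⊢
      obtain ⟨⟨⟨e1, e2, e3, e4⟩, hn⟩, -⟩ := hx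
      have g1 := hg (a, b) (by simp)
      have g2 := hg (b, c) (by simp)
      have g3 := hg (c, d) (by simp)
      have g4 := hg (d, e) (by simp)
      exact ⟨⟨hadj _ _ e1 g1.1 g1.2, hadj _ _ e2 g2.1 g2.2, hadj _ _ e3 g3.1 g3.2,
        hadj _ _ e4 g4.1 g4.2⟩, hn⟩
    · intro x hx
      rw [hN, Finset.mem_image] at hx
      obtain ⟨⟨⟨x, y⟩, v⟩, hp, rfl⟩ := hx
      simp only [Finset.mem_product, Finset.mem_offDiag] at hp
      obtain ⟨⟨hx, hy, hxy⟩, hv⟩ := hp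
      have hA' : ∀ a ∈ A, a ∉ D := fun a ha haD => hDA a haD ha
      have key : ∀ a ∈ A, ∀ b ∈ B, (G.replaceNeighbors D A).Adj a b := fun a ha b hb =>
        Or.inl ⟨hA' a ha, hBD b hb, hAB a ha b hb⟩
      have hαv := hα v hv
      have k1 := key _ (hβA v) _ hx
      have k2 := key _ (hβA v) _ hy
      have k3 := key _ hαv.1 _ hy
      have k4 : (G.replaceNeighbors D A).Adj (α v) v := Or.inr (Or.inr ⟨hαv.1, hA' _ hαv.1, hv⟩)
      have k5 := key _ hαv.1 _ hx
      have n1 : x ≠ v := fun h => hBD x hx (h ▸ hv)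
      have n2 : y ≠ v := fun h => hBD y hy (h ▸ hv)
      have n3 : β v ≠ v := fun h => hDA v hv (h ▸ hβA v)
      rw [mem_fivePaths]
      refine ⟨⟨k1.symm, k2, k3.symm, k4⟩, ?_⟩
      simp [hxy, n1, n2, n3, hβ v, k1.ne', k2.ne, k3.ne', k4.ne, k5.ne']
  have hdisj : Disjoint (G.fivePaths \ T) N := by
    rw [Finset.disjoint_left]
    intro x hx hxN
    rw [hN, Finset.mem_image] at hxN
    obtain ⟨⟨⟨x, y⟩, v⟩, hp, rfl⟩ := hxN
    rw [Finset.mem_sdiff, mem_fivePaths] at hx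
    exact (hα v (Finset.mem_product.1 hp).2).2 hx.1.1.2.2.2
  have h3 := Finset.card_le_card hsub
  rw [Finset.card_union_of_disjoint hdisj, hNcard] at h3
  have h4 := hmax _ (free_replaceNeighbors (D := D) hfree hAB hcard)
  have h5 := Finset.le_card_sdiff T G.fivePaths
  omega

end Paths

/-! ### Structure of an extremal graph around the core `A` -/

section Structure

open scoped Classical

/-- If the vertices of `A` have many common neighbours, then there is a path on `2 * #A` vertices
which starts at a given vertex of `A` and avoids a given set. -/
lemma exists_path_from {V : Type*} {G : SimpleGraph V} {A B W : Finset V}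
    (hAB : ∀ a ∈ A, ∀ b ∈ B, G.Adj a b) (hW : Disjoint A W)
    (hcard : 3 * A.card + W.card < B.card) {a : V} (ha : a ∈ A) :
    ∃ l : List V, (a :: l).IsChain G.Adj ∧ (a :: l).Nodup ∧ l.length + 1 = 2 * A.card ∧
      ∀ x ∈ a :: l, x ∉ W := by
  have hmem : ∀ x ∈ a :: (A.erase a).toList, x ∈ A := by
    intro x hx
    simp only [List.mem_cons, Finset.mem_toList, Finset.mem_erase] at hx
    rcases hx with rfl | hx
    · exact ha
    · exact hx.2
  have hlen : (A.erase a).toList.length + 1 = A.card := by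
    rw [Finset.length_toList, Finset.card_erase_add_one ha]
  have hXc := Finset.card_union_le A W
  obtain ⟨l, hc, hn, hl, hm⟩ := exists_alternating_path (G := G) B (A ∪ W) [] (by simp) (by simp)
    (A.erase a).toList a (fun x hx => hAB x (hmem x hx))
    (fun x hx => Finset.mem_union_left _ (hmem x hx))
    (by simp [Finset.nodup_toList]) (by simp only [List.length_nil]; omega)
  refine ⟨l, hc, hn, by simp only [List.length_nil] at hl; omega, ?_⟩
  intro x hx hxW
  have hA : ∀ y ∈ A, y ∉ W := fun y hy => Finset.disjoint_left.1 hW hy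
  rcases List.mem_cons.1 hx with rfl | hx
  · exact hA _ ha hxW
  · rcases hm x hx with h | h | h
    · exact hA _ (hmem x (List.mem_cons_of_mem _ h)) hxW
    · simp at h
    · exact h.2 (Finset.mem_union_right _ hxW)

/-- Otherwise `w₂, w₁, a` continues through all of `A`, alternating with `B`, to a path on `2 * #A +
2` vertices. -/
lemma not_adj_of_adj_of_free {V : Type*} {G : SimpleGraph V} {k : ℕ} {A B : Finset V}
    (hfree : (edgePath k).Free G) (hAB : ∀ a ∈ A, ∀ b ∈ B, G.Adj a b)
    (hcard : 3 * A.card + 10 ≤ B.card) (hk : k + 1 ≤ 2 * A.card + 2) {a w₁ w₂ : V} (ha : a ∈ A)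
    (h₁ : w₁ ∉ A) (h₂ : w₂ ∉ A) (haw : G.Adj a w₁) : ¬ G.Adj w₁ w₂ := by
  intro h12
  have hW : ({w₁, w₂} : Finset V).card ≤ 2 := Finset.card_le_two
  obtain ⟨l, hc, hn, hl, hm⟩ := exists_path_from (W := {w₁, w₂}) hAB
    (by simp [h₁, h₂]) (by omega) ha
  refine hfree (edgePath_isContained_of_isChain (l := w₂ :: w₁ :: a :: l) ?_ ?_ (by simp; omega))
  · exact List.isChain_cons_cons.2 ⟨h12.symm, List.isChain_cons_cons.2 ⟨haw.symm, hc⟩⟩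
  · rw [List.nodup_cons, List.nodup_cons]
    refine ⟨?_, fun h => hm _ h (by simp), hn⟩
    rw [List.mem_cons, not_or]
    exact ⟨h12.ne', fun h => hm _ h (by simp)⟩

/-- The same construction with three vertices in front of `a` yields `2 * #A + 3` vertices. -/
lemma not_adj_of_adj_of_adj_of_free {V : Type*} {G : SimpleGraph V} {k : ℕ} {A B : Finset V}
    (hfree : (edgePath k).Free G) (hAB : ∀ a ∈ A, ∀ b ∈ B, G.Adj a b)
    (hcard : 3 * A.card + 10 ≤ B.card) (hk : k + 1 ≤ 2 * A.card + 3) {a w₁ w₂ w₃ : V}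
    (ha : a ∈ A) (h₁ : w₁ ∉ A) (h₂ : w₂ ∉ A) (h₃ : w₃ ∉ A) (h₁₃ : w₁ ≠ w₃) (haw : G.Adj a w₁)
    (h12 : G.Adj w₁ w₂) : ¬ G.Adj w₂ w₃ := by
  intro h23
  have hW : ({w₁, w₂, w₃} : Finset V).card ≤ 3 := Finset.card_le_three
  obtain ⟨l, hc, hn, hl, hm⟩ := exists_path_from (W := {w₁, w₂, w₃}) hAB
    (by simp [h₁, h₂, h₃]) (by omega) ha
  refine hfree (edgePath_isContained_of_isChain (l := w₃ :: w₂ :: w₁ :: a :: l) ?_ ?_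
    (by simp; omega))
  · exact List.isChain_cons_cons.2 ⟨h23.symm, List.isChain_cons_cons.2 ⟨h12.symm,
      List.isChain_cons_cons.2 ⟨haw.symm, hc⟩⟩⟩
  · refine List.nodup_cons.2 ⟨?_, List.nodup_cons.2 ⟨?_, List.nodup_cons.2
      ⟨fun h => hm _ h (by simp), hn⟩⟩⟩
    · rw [List.mem_cons, List.mem_cons, not_or, not_or]
      exact ⟨h23.ne', h₁₃.symm, fun h => hm _ h (by simp)⟩
    · rw [List.mem_cons, not_or]
      exact ⟨h12.ne', fun h => hm _ h (by simp)⟩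

/-- Two disjoint edges outside `A` can only be attached to `A` at the same vertex. -/
lemma eq_of_disjoint_edges_of_free {V : Type*} {G : SimpleGraph V} {k : ℕ} {A B : Finset V}
    (hfree : (edgePath k).Free G) (hAB : ∀ a ∈ A, ∀ b ∈ B, G.Adj a b)
    (hcard : 3 * A.card + 10 ≤ B.card) (hk : k + 1 ≤ 2 * A.card + 3) {a a' x y z w : V}
    (ha : a ∈ A) (ha' : a' ∈ A) (hx : x ∉ A) (hy : y ∉ A) (hz : z ∉ A) (hw : w ∉ A)
    (hxy : G.Adj x y) (hzw : G.Adj z w) (hxz : x ≠ z) (hxw : x ≠ w) (hyz : y ≠ z) (hyw : y ≠ w)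
    (hax : G.Adj a x) (haz : G.Adj a' z) : a = a' := by
  by_contra hne
  set X : Finset V := A ∪ {x, y, z, w} with hX
  have hXc : X.card ≤ A.card + 4 :=
    (Finset.card_union_le _ _).trans (Nat.add_le_add_left Finset.card_le_four _)
  have ha'' : a' ∈ A.erase a := Finset.mem_erase.2 ⟨fun h => hne h.symm, ha'⟩
  have hmem : ∀ u ∈ a :: ((A.erase a).erase a').toList, u ∈ A := by
    intro u hu
    simp only [List.mem_cons, Finset.mem_toList, Finset.mem_erase] at hu
    rcases hu with rfl | hu
    · exact ha
    · exact hu.2.2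
  have hlen : ((A.erase a).erase a').toList.length + 2 = A.card := by
    have h1 := Finset.card_erase_add_one ha''
    have h2 := Finset.card_erase_add_one ha
    rw [Finset.length_toList]
    omega
  have haz' : a' ≠ z := haz.ne
  have haw' : a' ≠ w := fun h => hw (h ▸ ha')
  have naz : a ≠ z := fun h => hz (h ▸ ha)
  have naw : a ≠ w := fun h => hw (h ▸ ha)
  -- The path is `y, x, a, …, a', z, w`. It visits all of `A` with one vertex of `B` between
  -- consecutive members, so it has `#A + (#A - 1) + 4 = 2 * #A + 3` vertices.
  obtain ⟨l, hc, hn, hl, hm⟩ := exists_alternating_path (G := G) B X [a', z, w]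
    (fun b hb => by simp [(hAB a' ha' b hb).symm, haz, hzw])
    (by simp [hX, ha']) ((A.erase a).erase a').toList a (fun u hu => hAB u (hmem u hu))
    (fun u hu => Finset.mem_union_left _ (hmem u hu)) (by
      rw [List.nodup_append]
      refine ⟨by simp [Finset.nodup_toList], by simp [haz', haw', hzw.ne], ?_⟩
      intro u hu v hv
      simp only [List.mem_cons, Finset.mem_toList, Finset.mem_erase, List.not_mem_nil,
        or_false] at hu hv
      rcases hu with rfl | hu
      · rcases hv with rfl | rfl | rfl <;> assumption
      · rcases hv with rfl | rfl | rfl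
        · exact hu.1
        · exact fun h => hz (h ▸ hu.2.2)
        · exact fun h => hw (h ▸ hu.2.2))
    (by simp only [List.length_cons, List.length_nil]; omega)
  have havoid : ∀ u, u ∈ X → u ∉ A → u ≠ z → u ≠ w → u ∉ a :: l := by
    intro u huX huA huz huw hu
    rcases List.mem_cons.1 hu with rfl | hu
    · exact huA ha
    · rcases hm u hu with h | h | h
      · exact huA (hmem u (List.mem_cons_of_mem _ h))
      · simp only [List.mem_cons, List.not_mem_nil, or_false] at h
        rcases h with rfl | rfl | rfl
        · exact huA ha'
        · exact huz rfl
        · exact huw rfl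
      · exact h.2 huX
  refine hfree (edgePath_isContained_of_isChain (l := y :: x :: a :: l) ?_ ?_ ?_)
  · exact List.isChain_cons_cons.2 ⟨hxy.symm, List.isChain_cons_cons.2 ⟨hax.symm, hc⟩⟩
  · rw [List.nodup_cons, List.nodup_cons, List.mem_cons, not_or]
    exact ⟨⟨hxy.ne', havoid y (by simp [hX]) hy hyz hyw⟩, havoid x (by simp [hX]) hx hxz hxw, hn⟩
  · simp only [List.length_cons, List.length_nil] at hl ⊢
    omega

/-- A path-free graph has no large complete bipartite subgraph with too many vertices in the
smaller class. -/
lemma card_commonNeighbors_lt_of_free {V : Type*} {G : SimpleGraph V} {k : ℕ} {A B : Finset V}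
    (hfree : (edgePath k).Free G) (hAB : ∀ a ∈ A, ∀ b ∈ B, G.Adj a b)
    (hA : A.Nonempty) (hk : k + 1 ≤ 2 * A.card + 1) : B.card < 3 * A.card + 10 := by
  by_contra! hcard
  obtain ⟨a, ha⟩ := hA
  obtain ⟨b, hb⟩ : B.Nonempty := Finset.card_pos.1 (by omega)
  have hbA : b ∉ A := fun h => G.irrefl (hAB b h b hb)
  obtain ⟨l, hc, hn, hl, hm⟩ := exists_path_from (W := {b}) hAB (by simp [hbA]) (by simp; omega) ha
  refine hfree (edgePath_isContained_of_isChain (l := b :: a :: l) ?_ ?_ (by simp; omega))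
  · exact List.isChain_cons_cons.2 ⟨(hAB a ha b hb).symm, hc⟩
  · exact List.nodup_cons.2 ⟨fun h => hm _ h (by simp), hn⟩

lemma Reachable.mem_of_closed {V : Type*} {G : SimpleGraph V} {P : V → Prop}
    (hP : ∀ u v, G.Adj u v → P u → P v) {u v : V} (h : G.Reachable u v) (hu : P u) : P v := by
  obtain ⟨p⟩ := h
  induction p with
  | nil => exact hu
  | cons h _ ih => exact ih (hP _ _ h hu)

section Maximal

variable {V : Type*} [Fintype V] {G : SimpleGraph V} {k : ℕ} {A B : Finset V}

/-- A graph with the maximum number of four-edge paths is connected. -/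
lemma reachable_of_maximal (hfree : (edgePath k).Free G)
    (hmax : ∀ G' : SimpleGraph V, (edgePath k).Free G' → G'.fivePaths.card ≤ G.fivePaths.card)
    (hAB : ∀ a ∈ A, ∀ b ∈ B, G.Adj a b) (hcard : 2 * (k + 1) ≤ B.card) (hA : 2 ≤ A.card)
    (hsmall : (2 * k * (Fintype.card V - B.card)) ^ 2 < B.card * B.card - B.card)
    {a : V} (ha : a ∈ A) (v : V) : G.Reachable a v := by
  set U : Finset V := Finset.univ.filter fun v => ¬ G.Reachable a v with hU
  have hmemU : ∀ v, v ∈ U ↔ ¬ G.Reachable a v := by simp [hU]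
  have hclosed : ∀ u v, G.Adj u v → (u ∈ U ↔ v ∈ U) := by
    intro u v huv
    rw [hmemU, hmemU, not_iff_not]
    exact ⟨fun h => h.trans huv.reachable, fun h => h.trans huv.symm.reachable⟩
  obtain ⟨b₀, hb₀⟩ : B.Nonempty := Finset.card_pos.1 (by omega)
  have hUA : ∀ v ∈ U, v ∉ A := fun v hv hvA =>
    (hmemU v).1 hv ((hAB a ha b₀ hb₀).reachable.trans (hAB v hvA b₀ hb₀).symm.reachable)
  have hUB : Disjoint U B := Finset.disjoint_left.2 fun v hv hvB =>
    (hmemU v).1 hv (hAB a ha v hvB).reachable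
  have hUcard : U.card ≤ Fintype.card V - B.card := by
    have h1 := Finset.card_le_univ (U ∪ B)
    rw [Finset.card_union_of_disjoint hUB] at h1
    omega
  -- `U` is a union of components, so a path meeting `U` has its middle vertex and both end edges
  -- inside `U`. Thus at most `#U * (2 * k * #U) ^ 2` paths are lost, fewer than are gained unless
  -- `U` is empty.
  set T := G.fivePaths.filter fun x => x.2.2.1 ∈ U with hT
  have h := card_le_of_replaceNeighbors (D := U) hfree hmax hAB hcard hA hUA
    (fun v hv => ⟨a, ha, fun h => (hmemU v).1 hv h.reachable⟩) T (by
      intro a b c d e hx hxT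
      rw [hT, Finset.mem_filter, not_and] at hxT
      have hc := hxT hx
      rw [mem_fivePaths] at hx
      have e1 := hclosed _ _ hx.1.1
      have e2 := hclosed _ _ hx.1.2.1
      have e3 := hclosed _ _ hx.1.2.2.1
      have e4 := hclosed _ _ hx.1.2.2.2
      simp only at hc
      intro p hp
      simp only [List.mem_cons, List.not_mem_nil, or_false] at hp
      rcases hp with rfl | rfl | rfl | rfl <;> simp only <;> tauto)
  have hTcard : T.card ≤ (U ×ˢ (G.dartsIn U ×ˢ G.dartsIn U)).card := by
    refine Finset.card_le_card_of_injOn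
      (fun x => (x.2.2.1, (x.1, x.2.1), (x.2.2.2.1, x.2.2.2.2))) ?_ ?_
    · rintro ⟨a, b, c, d, e⟩ hx
      rw [Finset.mem_coe, hT, Finset.mem_filter, mem_fivePaths] at hx
      obtain ⟨⟨⟨e1, e2, e3, e4⟩, -⟩, hc⟩ := hx
      have f1 := hclosed _ _ e1
      have f2 := hclosed _ _ e2
      have f3 := hclosed _ _ e3
      have f4 := hclosed _ _ e4
      simp only at hc
      simp only [Finset.mem_coe, Finset.mem_product, mem_dartsIn]
      tauto
    · rintro ⟨a, b, c, d, e⟩ - ⟨a', b', c', d', e'⟩ - h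
      simp only [Prod.mk.injEq] at h ⊢
      tauto
  rw [Finset.card_product, Finset.card_product] at hTcard
  have hd := card_dartsIn_le hfree U
  by_contra hv
  have hpos : 0 < U.card := Finset.card_pos.2 ⟨v, (hmemU v).2 hv⟩
  have h2 : (B.card * B.card - B.card) * U.card ≤
      (2 * k * (Fintype.card V - B.card)) ^ 2 * U.card := by
    calc _ ≤ U.card * ((G.dartsIn U).card * (G.dartsIn U).card) := h.trans hTcard
      _ ≤ U.card * ((2 * k * (Fintype.card V - B.card)) * (2 * k * (Fintype.card V - B.card))) := by
        have := hd.trans (Nat.mul_le_mul_left (2 * k) hUcard)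
        gcongr
      _ = _ := by ring
  exact absurd (Nat.le_of_mul_le_mul_right h2 hpos) (by omega)

/-- In a graph with the maximum number of four-edge paths, a vertex `x` outside `A` which is not
joined to all of `A` and has at most one further neighbour `y` cannot lie in very few paths. -/
lemma adj_of_maximal (hfree : (edgePath k).Free G)
    (hmax : ∀ G' : SimpleGraph V, (edgePath k).Free G' → G'.fivePaths.card ≤ G.fivePaths.card)
    (hAB : ∀ a ∈ A, ∀ b ∈ B, G.Adj a b) (hcard : 2 * (k + 1) ≤ B.card) (hA : 2 ≤ A.card)
    (hlarge : 8 * k * A.card * Fintype.card V < B.card * B.card - B.card)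
    {x y : V} (hx : x ∉ A) (hN : ∀ z, G.Adj x z → z ∈ A ∨ z = y)
    (hend : ∀ z w, G.Adj y z → G.Adj z w → z ≠ x → w ≠ y → z ∈ A)
    (hmid : ∀ z w, G.Adj x z → G.Adj y w → z ≠ y → w ≠ x → z = w)
    {a : V} (ha : a ∈ A) : G.Adj a x := by
  by_contra hax
  set f : (V × V) × V × (V × V) → V × V × V × V × V :=
    fun p => (p.1.1, p.1.2, p.2.1, p.2.2.1, p.2.2.2) with hf
  set g : (V × V) × V × (V × V) → V × V × V × V × V :=
    fun p => (p.2.2.1, p.2.2.2, p.2.1, p.1.1, p.1.2) with hg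
  -- A destroyed path uses the edge `xy`. By `hmid` that edge cannot be an inner edge of the path,
  -- and by `hN` and `hend` the next vertex after it lies in `A`. Such a path is fixed by the
  -- orientation of `xy`, a vertex of `A`, an oriented edge and the end at which `xy` sits, so the
  -- loss is linear in the number of vertices.
  set S : Finset ((V × V) × V × (V × V)) :=
    {(x, y), (y, x)} ×ˢ (A ×ˢ G.dartsIn Finset.univ) with hS
  set T := S.image f ∪ S.image g with hT
  have h := card_le_of_replaceNeighbors (D := {x}) hfree hmax hAB hcard hA
    (by simpa using hx) (by simpa using ⟨a, ha, hax⟩) T (by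
      intro a b c d e hxp hxT
      rw [mem_fivePaths] at hxp
      obtain ⟨⟨e1, e2, e3, e4⟩, hn⟩ := hxp
      simp only [List.nodup_cons, List.mem_cons, List.not_mem_nil, or_false, not_or,
        not_false_eq_true, List.nodup_nil, and_true] at hn
      obtain ⟨⟨-, nac, nad, -⟩, ⟨-, nbd, nbe⟩, ⟨-, nce⟩, -⟩ := hn
      have hS1 : ((a = x ∧ b = y) ∨ (a = y ∧ b = x)) → c ∉ A := fun h hc => hxT
        (Finset.mem_union_left _ (Finset.mem_image.2 ⟨((a, b), c, (d, e)), by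
          simpa [hS, hc, e4] using h, rfl⟩))
      have hS2 : ((d = x ∧ e = y) ∨ (d = y ∧ e = x)) → c ∉ A := fun h hc => hxT
        (Finset.mem_union_right _ (Finset.mem_image.2 ⟨((d, e), c, (a, b)), by
          simpa [hS, hc, e1] using h, rfl⟩))
      have hedge : ∀ p : V × V, G.Adj p.1 p.2 → ¬ ((p.1 = x ∧ p.2 = y) ∨ (p.1 = y ∧ p.2 = x)) →
          (p.1 ∈ ({x} : Finset V) → p.2 ∈ A) ∧ (p.2 ∈ ({x} : Finset V) → p.1 ∈ A) := by
        rintro ⟨u, v⟩ huv hne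
        simp only [Finset.mem_singleton] at hne ⊢
        constructor
        · rintro rfl
          exact (hN v huv).resolve_right fun h => hne (Or.inl ⟨rfl, h⟩)
        · rintro rfl
          exact (hN u huv.symm).resolve_right fun h => hne (Or.inr ⟨h, rfl⟩)
      intro p hp
      simp only [List.mem_cons, List.not_mem_nil, or_false] at hp
      rcases hp with rfl | rfl | rfl | rfl
      · refine hedge _ e1 fun h => hS1 h ?_
        rcases h with ⟨rfl, rfl⟩ | ⟨rfl, rfl⟩
        · exact hend c d e2 e3 (Ne.symm nac) (Ne.symm nbd)
        · exact (hN c e2).resolve_right (Ne.symm nac)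
      · refine hedge _ e2 fun h => ?_
        rcases h with ⟨rfl, rfl⟩ | ⟨rfl, rfl⟩
        · exact nad (hmid a d e1.symm e3 nac (Ne.symm nbd))
        · exact nad (hmid d a e3 e1.symm (Ne.symm nbd) nac).symm
      · refine hedge _ e3 fun h => ?_
        rcases h with ⟨rfl, rfl⟩ | ⟨rfl, rfl⟩
        · exact nbe (hmid b e e2.symm e4 nbd (Ne.symm nce))
        · exact nbe (hmid e b e4 e2.symm (Ne.symm nce) nbd).symm
      · refine hedge _ e4 fun h => hS2 h ?_
        rcases h with ⟨rfl, rfl⟩ | ⟨rfl, rfl⟩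
        · exact (hN c e3.symm).resolve_right nce
        · exact hend c b e3.symm e2.symm nce nbd)
  have hTcard : T.card ≤ 2 * S.card := by
    have h1 := Finset.card_union_le (S.image f) (S.image g)
    have h2 := Finset.card_image_le (s := S) (f := f)
    have h3 := Finset.card_image_le (s := S) (f := g)
    rw [hT]
    omega
  have hScard : S.card ≤ 2 * (A.card * (2 * k * Fintype.card V)) := by
    rw [hS, Finset.card_product, Finset.card_product]
    have h1 := card_dartsIn_le hfree (Finset.univ : Finset V)
    rw [Finset.card_univ] at h1
    gcongr
    exact Finset.card_le_two
  rw [Finset.card_singleton, mul_one] at h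
  have : 2 * (2 * (A.card * (2 * k * Fintype.card V))) = 8 * k * A.card * Fintype.card V := by ring
  omega

/-- The structure of a graph with the maximum number of four-edge paths: outside `A` there is at
most one edge, and none if `k` is odd. -/
lemma edges_of_maximal (hfree : (edgePath k).Free G)
    (hmax : ∀ G' : SimpleGraph V, (edgePath k).Free G' → G'.fivePaths.card ≤ G.fivePaths.card)
    (hAB : ∀ a ∈ A, ∀ b ∈ B, G.Adj a b) (hA : 2 ≤ A.card) (hk : k ≤ 2 * A.card + 2)
    (hcard : 2 * (k + 1) ≤ B.card) (hcard' : 3 * A.card + 10 ≤ B.card)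
    (hsmall : (2 * k * (Fintype.card V - B.card)) ^ 2 < B.card * B.card - B.card)
    (hlarge : 8 * k * A.card * Fintype.card V < B.card * B.card - B.card)
    {x y : V} (hx : x ∉ A) (hy : y ∉ A) (hxy : G.Adj x y) :
    k = 2 * A.card + 2 ∧ ∀ z w, z ∉ A → w ∉ A → G.Adj z w → (z = x ∧ w = y) ∨ (z = y ∧ w = x) := by
  have F3 : ∀ w₁ w₂ w₃, w₁ ∉ A → w₂ ∉ A → w₃ ∉ A → w₁ ≠ w₃ → (∃ a ∈ A, G.Adj a w₁) →
      G.Adj w₁ w₂ → ¬ G.Adj w₂ w₃ := fun w₁ w₂ w₃ h1 h2 h3 h13 ⟨a, ha, haw⟩ h12 =>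
    not_adj_of_adj_of_adj_of_free hfree hAB hcard' (by omega) ha h1 h2 h3 h13 haw h12
  obtain ⟨a₀, ha₀⟩ : A.Nonempty := Finset.card_pos.1 (by omega)
  -- By connectivity every vertex is reached from `A`, and `F3` stops any excursion outside `A`
  -- after two vertices.
  have hnear : ∀ v, v ∈ A ∨ (∃ a ∈ A, G.Adj a v) ∨
      ∃ w, w ∉ A ∧ (∃ a ∈ A, G.Adj a w) ∧ G.Adj w v := by
    intro v
    refine (reachable_of_maximal hfree hmax hAB hcard hA hsmall ha₀ v).mem_of_closed
      (P := fun v => v ∈ A ∨ (∃ a ∈ A, G.Adj a v) ∨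
        ∃ w, w ∉ A ∧ (∃ a ∈ A, G.Adj a w) ∧ G.Adj w v) ?_ (Or.inl ha₀)
    rintro u v huv hu
    by_cases hvA : v ∈ A
    · exact Or.inl hvA
    by_cases huA : u ∈ A
    · exact Or.inr (Or.inl ⟨u, huA, huv⟩)
    rcases hu with h | h | ⟨w, hwA, hw, hwu⟩
    · exact absurd h huA
    · exact Or.inr (Or.inr ⟨u, huA, h, huv⟩)
    · by_cases hwv : w = v
      · exact Or.inr (Or.inl (hwv ▸ hw))
      · exact absurd huv (F3 w u v hwA huA hvA hwv hw hwu)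
  -- A vertex without neighbours in `A` would be a leaf hanging from `w`; `adj_of_maximal` then
  -- joins it to `A`, a contradiction.
  have hatt : ∀ v, v ∉ A → ∃ a ∈ A, G.Adj a v := by
    intro v hv
    by_contra hnatt
    rcases hnear v with h | h | ⟨w, hwA, hw, hwv⟩
    · exact hv h
    · exact hnatt h
    have hNv : ∀ z, G.Adj v z → z = w := by
      intro z hz
      by_contra hzw
      have hzA : z ∉ A := fun h => hnatt ⟨z, h, hz.symm⟩
      exact F3 w v z hwA hv hzA (fun h => hzw h.symm) hw hwv hz
    refine hnatt ⟨a₀, ha₀, adj_of_maximal (y := w) hfree hmax hAB hcard hA hlarge hv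
      (fun z hz => Or.inr (hNv z hz)) ?_ (fun z _ hz _ hzw _ => absurd (hNv z hz) hzw) ha₀⟩
    intro z u hwz hzu hzv huw
    by_contra hzA
    by_cases hz : ∃ a ∈ A, G.Adj a z
    · exact F3 z w v hzA hwA hv hzv hz hwz.symm hwv
    · have huA : u ∉ A := fun h => hz ⟨u, h, hzu.symm⟩
      exact F3 w z u hwA hzA huA (fun h => huw h.symm) hw hwz hzu
  -- Now that every outside vertex is attached to `A`, `F3` turns the edges outside `A` into a
  -- matching.
  have hmatch : ∀ u v w, u ∉ A → v ∉ A → w ∉ A → G.Adj u v → G.Adj v w → u = w := by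
    intro u v w hu hv hw huv hvw
    by_contra huw
    exact F3 u v w hu hv hw huw (hatt u hu) huv hvw
  constructor
  · by_contra hk'
    obtain ⟨a, ha, hax⟩ := hatt x hx
    exact not_adj_of_adj_of_free hfree hAB hcard' (by omega) ha hx hy hax hxy
  · intro z w hz hw hzw
    by_contra hne
    have hxz : x ≠ z := by
      rintro rfl
      have := hmatch y x w hy hx hw hxy.symm hzw
      tauto
    have hxw : x ≠ w := by
      rintro rfl
      have := hmatch y x z hy hx hz hxy.symm hzw.symm
      tauto
    have hyz : y ≠ z := by
      rintro rfl
      have := hmatch x y w hx hy hw hxy hzw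
      tauto
    have hyw : y ≠ w := by
      rintro rfl
      have := hmatch x y z hx hy hz hxy hzw.symm
      tauto
    -- With two disjoint outside edges, `x` and `y` can see only the one vertex `a` of `A`. The edge
    -- `xy` then lies on too few paths, and `adj_of_maximal` joins `x` to a second vertex of `A`.
    obtain ⟨a, ha, haz⟩ := hatt z hz
    have hax : ∀ a' ∈ A, G.Adj a' x → a' = a := fun a' ha' h =>
      eq_of_disjoint_edges_of_free hfree hAB hcard' (by omega) ha' ha hx hy hz hw hxy hzw
        hxz hxw hyz hyw h haz
    have hay : ∀ a' ∈ A, G.Adj a' y → a' = a := fun a' ha' h =>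
      eq_of_disjoint_edges_of_free hfree hAB hcard' (by omega) ha' ha hy hx hz hw hxy.symm hzw
        hyz hyw hxz hxw h haz
    have hNx : ∀ u, G.Adj x u → u ≠ y → u = a := by
      intro u hu huy
      by_cases huA : u ∈ A
      · exact hax u huA hu.symm
      · exact absurd (hmatch y x u hy hx huA hxy.symm hu) (Ne.symm huy)
    have hNy : ∀ u, G.Adj y u → u ≠ x → u = a := by
      intro u hu hux
      by_cases huA : u ∈ A
      · exact hay u huA hu.symm
      · exact absurd (hmatch x y u hx hy huA hxy hu) (Ne.symm hux)
    obtain ⟨a', ha', hne'⟩ : ∃ a' ∈ A, a' ≠ a :=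
      (Finset.one_lt_card_iff_nontrivial.1 hA).exists_ne a
    refine hne' (hax a' ha' (adj_of_maximal (y := y) hfree hmax hAB hcard hA hlarge hx ?_ ?_ ?_ ha'))
    · intro u hu
      by_cases huy : u = y
      · exact Or.inr huy
      · exact Or.inl (hNx u hu huy ▸ ha)
    · intro u _ hu _ hux _
      exact hNy u hu hux ▸ ha
    · intro u v hu hv huy hvx
      rw [hNx u hu huy, hNy v hv hvx]

end Maximal

end Structure

/-! ### Stability: a near-extremal graph has `t` vertices of almost full degree -/

section Stability

open scoped Classical

/-- A weighted count of ordered pairs from a set which does not consist of `t` vertices of almost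
full weight. -/
lemma sum_offDiag_mul_le {V : Type*} (S : Finset V) (w : V → ℕ) {n q t : ℕ} (ht : 2 ≤ t)
    (hq : 0 < q) (hw : ∀ v, w v ≤ n) (hS : S.card ≤ t)
    (hbad : S.card = t → ∃ a ∈ S, q * w a + n ≤ q * n) :
    q * (∑ p ∈ S.offDiag, w p.1 * w p.2) + n ^ 2 ≤ q * (t * (t - 1)) * n ^ 2 := by
  obtain ⟨s, rfl⟩ : ∃ s, t = s + 2 := ⟨t - 2, by omega⟩
  have hterm : ∀ p ∈ S.offDiag, w p.1 * w p.2 ≤ n ^ 2 := fun p _ => by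
    rw [pow_two]; exact Nat.mul_le_mul (hw _) (hw _)
  have htt : (s + 2) * (s + 2 - 1) = (s + 2) * s + s + 2 := by
    rw [show s + 2 - 1 = s + 1 by omega]; ring
  rw [htt]
  -- A smaller set misses at least one of the `t * (t - 1)` ordered pairs. A set of size `t` has a
  -- pair containing the light vertex `a`, whose product is at most `n ^ 2 - n ^ 2 / q`. Either way
  -- at least `n ^ 2 / q` is lost.
  rcases hS.lt_or_eq with hlt | heq
  · have hcard : S.offDiag.card ≤ (s + 2) * s + s + 1 := by
      rw [Finset.offDiag_card]
      have : S.card * S.card ≤ (s + 1) * S.card := Nat.mul_le_mul_right _ (by omega)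
      have h2 : s * S.card ≤ s * (s + 2) := Nat.mul_le_mul_left _ (by omega)
      have h3 : (s + 1) * S.card = s * S.card + S.card := by ring
      have h4 : s * (s + 2) = (s + 2) * s := by ring
      omega
    have h1 : ∑ p ∈ S.offDiag, w p.1 * w p.2 ≤ S.offDiag.card * n ^ 2 := by
      simpa using Finset.sum_le_card_nsmul S.offDiag _ _ hterm
    calc _ ≤ q * (((s + 2) * s + s + 1) * n ^ 2) + q * n ^ 2 := by
            gcongr
            · exact h1.trans (by gcongr)
            · exact Nat.le_mul_of_pos_left _ hq
      _ = _ := by ring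
  · obtain ⟨a, ha, hwa⟩ := hbad heq
    obtain ⟨b, hb, hba⟩ := (Finset.one_lt_card_iff_nontrivial.1 (by omega : 1 < S.card)).exists_ne a
    have hmem : (a, b) ∈ S.offDiag := Finset.mem_offDiag.2 ⟨ha, hb, hba.symm⟩
    rw [← Finset.add_sum_erase _ _ hmem]
    have hcard : (S.offDiag.erase (a, b)).card = (s + 2) * s + s + 1 := by
      have h1 := Finset.card_erase_add_one hmem
      rw [Finset.offDiag_card, heq] at h1
      have h3 : (s + 2) * (s + 2) = (s + 2) * s + s + 2 + (s + 2) := by ring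
      omega
    have h1 : ∑ p ∈ S.offDiag.erase (a, b), w p.1 * w p.2 ≤ ((s + 2) * s + s + 1) * n ^ 2 := by
      rw [← hcard]
      simpa using Finset.sum_le_card_nsmul (S.offDiag.erase (a, b)) _ _
        (fun p hp => hterm p (Finset.mem_of_mem_erase hp))
    have h2 : q * (w a * w b) + n ^ 2 ≤ q * n ^ 2 := by
      calc _ ≤ (q * w a) * n + n * n := by
              rw [← mul_assoc, pow_two]; gcongr; exact hw b
        _ = (q * w a + n) * n := by ring
        _ ≤ (q * n) * n := by gcongr
        _ = _ := by ring
    calc _ ≤ q * (w a * w b) + n ^ 2 + q * (((s + 2) * s + s + 1) * n ^ 2) := by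
            rw [mul_add]
            have := Nat.mul_le_mul_left q h1
            simp only at this ⊢
            omega
      _ ≤ q * n ^ 2 + q * (((s + 2) * s + s + 1) * n ^ 2) := by gcongr
      _ = _ := by ring

variable {V : Type*} [Fintype V] {G : SimpleGraph V}

lemma sum_card_neighborsIn (G : SimpleGraph V) :
    ∑ v, (G.neighborsIn Finset.univ v).card = (G.dartsIn Finset.univ).card := by
  rw [← Finset.card_sigma]
  refine Finset.card_bij (fun x _ => (x.1, x.2)) ?_ ?_ ?_
  · rintro ⟨v, w⟩ h
    simpa using h
  · rintro ⟨v, w⟩ - ⟨v', w'⟩ - h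
    simpa using h
  · rintro ⟨v, w⟩ h
    exact ⟨⟨v, w⟩, by simpa using h, rfl⟩

/-- There are few paths whose second vertex has small degree. -/
lemma card_fivePaths_filter_low_le {k M : ℕ} (hfree : (edgePath k).Free G) (L : Finset V)
    (hL : ∀ v ∈ L, M * (G.neighborsIn Finset.univ v).card ≤ Fintype.card V) :
    M * (G.fivePaths.filter fun x => x.2.1 ∈ L).card ≤
      (2 * k) ^ 2 * Fintype.card V ^ 3 := by
  set N := G.neighborsIn Finset.univ with hN
  have hd := card_dartsIn_le hfree (Finset.univ : Finset V)
  rw [Finset.card_univ] at hd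
  -- A path is encoded by `b`, two neighbours `a`, `c` of `b`, and the oriented edge `(d, e)`. The
  -- sum of squared degrees over `L` is at most `n / M` times the degree sum, which is at most `2 *
  -- k * n`.
  have h1 : (G.fivePaths.filter fun x => x.2.1 ∈ L).card ≤
      ((L.sigma fun b => N b ×ˢ N b) ×ˢ G.dartsIn Finset.univ).card := by
    refine Finset.card_le_card_of_injOn
      (fun x => (⟨x.2.1, (x.1, x.2.2.1)⟩, (x.2.2.2.1, x.2.2.2.2))) ?_ ?_
    · rintro ⟨a, b, c, d, e⟩ hx
      rw [Finset.mem_coe, Finset.mem_filter, mem_fivePaths] at hx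
      obtain ⟨⟨⟨e1, e2, e3, e4⟩, -⟩, hb⟩ := hx
      simp only [Finset.mem_coe, Finset.mem_product, Finset.mem_sigma, mem_dartsIn, hN,
        mem_neighborsIn, Finset.mem_univ, true_and]
      exact ⟨⟨hb, e1.symm, e2⟩, e4⟩
    · rintro ⟨a, b, c, d, e⟩ - ⟨a', b', c', d', e'⟩ - h
      simp only [Prod.mk.injEq, Sigma.mk.injEq, heq_eq_eq] at h ⊢
      tauto
  rw [Finset.card_product, Finset.card_sigma] at h1
  have h2 : M * ∑ b ∈ L, (N b ×ˢ N b).card ≤ Fintype.card V * (2 * k * Fintype.card V) := by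
    calc M * ∑ b ∈ L, (N b ×ˢ N b).card = ∑ b ∈ L, (M * (N b).card) * (N b).card := by
            rw [Finset.mul_sum]
            refine Finset.sum_congr rfl fun b _ => ?_
            rw [Finset.card_product, mul_assoc]
      _ ≤ ∑ b ∈ L, Fintype.card V * (N b).card :=
            Finset.sum_le_sum fun b hb => Nat.mul_le_mul_right _ (hL b hb)
      _ = Fintype.card V * ∑ b ∈ L, (N b).card := by rw [Finset.mul_sum]
      _ ≤ Fintype.card V * ∑ b, (N b).card := by
            gcongr
            exact Finset.subset_univ L
      _ ≤ _ := by
            rw [hN, sum_card_neighborsIn]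
            gcongr
  calc _ ≤ M * ((∑ b ∈ L, (N b ×ˢ N b).card) * (G.dartsIn Finset.univ).card) := by gcongr
    _ = (M * ∑ b ∈ L, (N b ×ˢ N b).card) * (G.dartsIn Finset.univ).card := by ring
    _ ≤ (Fintype.card V * (2 * k * Fintype.card V)) * (2 * k * Fintype.card V) := by gcongr
    _ = _ := by ring

/-- Each such vertex is a common neighbour of some `t + 1` vertices of `H`, and
`card_commonNeighbors_lt_of_free` bounds the common neighbours of each such subset. -/
lemma card_many_neighbors_le {k t : ℕ} (hfree : (edgePath k).Free G) (hk : k ≤ 2 * t + 2)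
    (H : Finset V) :
    (Finset.univ.filter fun c => t + 1 ≤ (G.neighborsIn H c).card).card ≤
      2 ^ H.card * (3 * t + 13) := by
  have hsub : (Finset.univ.filter fun c => t + 1 ≤ (G.neighborsIn H c).card) ⊆
      (H.powersetCard (t + 1)).biUnion fun S => Finset.univ.filter fun c => ∀ a ∈ S, G.Adj a c := by
    intro c hc
    rw [Finset.mem_filter] at hc
    obtain ⟨S, hS, hSc⟩ := Finset.exists_subset_card_eq hc.2
    rw [Finset.mem_biUnion]
    refine ⟨S, Finset.mem_powersetCard.2 ⟨fun x hx => (mem_neighborsIn.1 (hS hx)).1, hSc⟩, ?_⟩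
    exact Finset.mem_filter.2 ⟨Finset.mem_univ _, fun a ha => (mem_neighborsIn.1 (hS ha)).2.symm⟩
  refine (Finset.card_le_card hsub).trans ((Finset.card_biUnion_le_card_mul _ _ (3 * t + 13) ?_).trans
    ?_)
  · intro S hS
    rw [Finset.mem_powersetCard] at hS
    have := card_commonNeighbors_lt_of_free (A := S)
      (B := Finset.univ.filter fun c => ∀ a ∈ S, G.Adj a c) hfree
      (fun a ha b hb => (Finset.mem_filter.1 hb).2 a ha) (Finset.card_pos.1 (by omega)) (by omega)
    omega
  · gcongr
    rw [← Finset.card_powerset]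
    exact Finset.card_le_card (fun S hS => Finset.mem_powerset.2 (Finset.mem_powersetCard.1 hS).1)

/-- The number of paths whose second and fourth vertices lie in `H` and whose middle vertex has few
neighbours in `H`. -/
lemma card_fivePaths_filter_core_le {q t : ℕ} (ht : 2 ≤ t) (hq : 0 < q) (H : Finset V)
    (hbad : ∀ S : Finset V, S.card = t → ∃ a ∈ S,
      q * (G.neighborsIn Finset.univ a).card + Fintype.card V ≤ q * Fintype.card V) :
    q * (G.fivePaths.filter fun x => x.2.1 ∈ H ∧ x.2.2.2.1 ∈ H ∧
        (G.neighborsIn H x.2.2.1).card ≤ t).card + Fintype.card V ^ 3 ≤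
      q * (t * (t - 1)) * Fintype.card V ^ 3 := by
  set n := Fintype.card V with hn
  set N := G.neighborsIn Finset.univ with hN
  have hNn : ∀ v, (N v).card ≤ n := fun v => Finset.card_le_univ _
  -- Middle vertices with too many neighbours in `H` get the empty set, so that one bound per middle
  -- vertex holds uniformly and can be summed.
  set S : V → Finset V := fun c => if (G.neighborsIn H c).card ≤ t then G.neighborsIn H c else ∅
    with hS
  have hSt : ∀ c, (S c).card ≤ t := by
    intro c
    simp only [hS]
    split_ifs with h
    · exact h
    · simp
  have h1 : (G.fivePaths.filter fun x => x.2.1 ∈ H ∧ x.2.2.2.1 ∈ H ∧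
        (G.neighborsIn H x.2.2.1).card ≤ t).card ≤
      ((Finset.univ : Finset V).sigma fun c =>
        (S c).offDiag.sigma fun p => N p.1 ×ˢ N p.2).card := by
    refine Finset.card_le_card_of_injOn
      (fun x => ⟨x.2.2.1, ⟨(x.2.1, x.2.2.2.1), (x.1, x.2.2.2.2)⟩⟩) ?_ ?_
    · rintro ⟨a, b, c, d, e⟩ hx
      rw [Finset.mem_coe, Finset.mem_filter, mem_fivePaths] at hx
      obtain ⟨⟨⟨e1, e2, e3, e4⟩, hnd⟩, hb, hd, hc⟩ := hx
      simp only at hb hd hc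
      have hbd : b ≠ d := by
        rintro rfl
        simp at hnd
      simp only [Finset.mem_coe, Finset.mem_product, Finset.mem_sigma, hN, hS, if_pos hc,
        mem_neighborsIn, Finset.mem_univ, true_and, Finset.mem_offDiag]
      exact ⟨⟨⟨hb, e2.symm⟩, ⟨hd, e3⟩, hbd⟩, e1.symm, e4⟩
    · rintro ⟨a, b, c, d, e⟩ - ⟨a', b', c', d', e'⟩ - h
      simp only [Prod.mk.injEq, Sigma.mk.injEq, heq_eq_eq] at h ⊢
      tauto
  rw [Finset.card_sigma] at h1
  have h2 : ∀ c ∈ (Finset.univ : Finset V),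
      q * ((S c).offDiag.sigma fun p => N p.1 ×ˢ N p.2).card + n ^ 2 ≤
        q * (t * (t - 1)) * n ^ 2 := by
    intro c _
    have := sum_offDiag_mul_le (S c) (fun v => (N v).card) ht hq hNn (hSt c) (hbad _)
    simpa [Finset.card_sigma, Finset.card_product] using this
  have h3 := Finset.sum_le_sum h2
  rw [Finset.sum_add_distrib, ← Finset.mul_sum, Finset.sum_const, Finset.sum_const,
    Finset.card_univ, ← hn, smul_eq_mul, smul_eq_mul] at h3
  have h4 := Nat.mul_le_mul_left q h1
  calc _ ≤ q * ∑ c, ((S c).offDiag.sigma fun p => N p.1 ×ˢ N p.2).card + n * n ^ 2 := by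
          rw [show n * n ^ 2 = n ^ 3 by ring]
          omega
    _ ≤ n * (q * (t * (t - 1)) * n ^ 2) := h3
    _ = _ := by ring

lemma cube_le_sub_cube_add (n s : ℕ) : n ^ 3 ≤ (n - s) ^ 3 + 3 * s * n ^ 2 := by
  rcases le_total n s with hle | hle
  · have h1 : n ^ 3 = n * n ^ 2 := by ring
    have h2 : n * n ^ 2 ≤ (3 * s) * n ^ 2 := Nat.mul_le_mul_right _ (by omega)
    omega
  · obtain ⟨m, rfl⟩ := Nat.exists_eq_add_of_le hle
    rw [Nat.add_sub_cancel_left]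
    nlinarith [Nat.zero_le (m * s ^ 2), Nat.zero_le (s ^ 3)]

/-- A path-free graph with nearly the maximum number of four-edge paths has `t` vertices of almost
full degree. -/
theorem exists_core_of_card_fivePaths (k t q : ℕ) (ht : 2 ≤ t) (hk : k ≤ 2 * t + 2) (hq : 0 < q) :
    ∃ n₀ : ℕ, ∀ (V : Type) [Fintype V] (G : SimpleGraph V), n₀ < Fintype.card V →
      (edgePath k).Free G →
      t * (t - 1) * (Fintype.card V - (t + 2)) ^ 3 ≤ G.fivePaths.card →
      ∃ A : Finset V, A.card = t ∧ ∀ a ∈ A,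
        q * Fintype.card V < q * (G.neighborsIn Finset.univ a).card + Fintype.card V := by
  -- `M` makes the paths with a low-degree second or fourth vertex cost less than the gain `n ^ 3 /
  -- q`: the `+ 1` leaves a surplus of `n ^ 3` in `e4`. Then `h` bounds `#H`, and `K * n ^ 2` bounds
  -- the paths whose middle vertex has more than `t` neighbours in `H`.
  set M := 2 * q * (2 * k) ^ 2 + 1 with hM
  set h := M * (2 * k) with hh
  set K := 2 ^ h * (3 * t + 13) * (h * h) with hK
  refine ⟨q * M * (K + 3 * (t + 2) * (t * (t - 1))), fun V _ G hn hfree hlow => ?_⟩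
  by_contra! hbad
  set n := Fintype.card V with hnV
  have hnpos : 0 < n := by omega
  set H : Finset V := Finset.univ.filter fun v => n ≤ M * (G.neighborsIn Finset.univ v).card with hH
  have hd := card_dartsIn_le hfree (Finset.univ : Finset V)
  rw [Finset.card_univ, ← hnV] at hd
  have hHcard : H.card ≤ h := by
    have h1 : H.card * n ≤ ∑ v ∈ H, M * (G.neighborsIn Finset.univ v).card := by
      simpa using Finset.card_nsmul_le_sum H _ n (fun v hv => (Finset.mem_filter.1 hv).2)
    have h2 : ∑ v ∈ H, M * (G.neighborsIn Finset.univ v).card ≤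
        ∑ v, M * (G.neighborsIn Finset.univ v).card :=
      Finset.sum_le_sum_of_subset (Finset.subset_univ H)
    rw [← Finset.mul_sum (Finset.univ : Finset V), sum_card_neighborsIn] at h2
    have h3 : H.card * n ≤ h * n := by
      calc _ ≤ M * (2 * k * n) := h1.trans (h2.trans (Nat.mul_le_mul_left _ hd))
        _ = _ := by rw [hh]; ring
    exact Nat.le_of_mul_le_mul_right h3 hnpos
  set P₁ := G.fivePaths.filter fun x => x.2.1 ∈ Hᶜ with hP₁
  set P₂ := G.fivePaths.filter fun x => x.2.2.2.1 ∈ Hᶜ with hP₂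
  set Z := Finset.univ.filter fun c => t + 1 ≤ (G.neighborsIn H c).card with hZ
  set P₃ : Finset (V × V × V × V × V) := Finset.univ ×ˢ (H ×ˢ (Z ×ˢ (H ×ˢ Finset.univ))) with hP₃
  set P₄ := G.fivePaths.filter fun x => x.2.1 ∈ H ∧ x.2.2.2.1 ∈ H ∧
        (G.neighborsIn H x.2.2.1).card ≤ t with hP₄
  have hcover : G.fivePaths ⊆ P₁ ∪ P₂ ∪ P₃ ∪ P₄ := by
    intro x hx
    simp only [hP₁, hP₂, hP₃, hP₄, hZ, Finset.mem_union, Finset.mem_filter, Finset.mem_product,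
      Finset.mem_compl, Finset.mem_univ, true_and, hx, and_true]
    have := Nat.lt_or_ge t (G.neighborsIn H x.2.2.1).card
    rw [← Nat.succ_le_iff] at this
    tauto
  have hc1 : M * P₁.card ≤ (2 * k) ^ 2 * n ^ 3 := by
    refine card_fivePaths_filter_low_le hfree Hᶜ fun v hv => ?_
    simp [hH] at hv
    exact hv.le
  have hc2 : P₂.card ≤ P₁.card := by
    refine Finset.card_le_card_of_injOn
      (fun x => (x.2.2.2.2, x.2.2.2.1, x.2.2.1, x.2.1, x.1)) ?_ ?_
    · rintro ⟨a, b, c, d, e⟩ hx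
      rw [Finset.mem_coe, hP₂, Finset.mem_filter, mem_fivePaths] at hx
      rw [Finset.mem_coe, hP₁, Finset.mem_filter, mem_fivePaths]
      refine ⟨⟨⟨hx.1.1.2.2.2.symm, hx.1.1.2.2.1.symm, hx.1.1.2.1.symm, hx.1.1.1.symm⟩, ?_⟩, hx.2⟩
      have := List.nodup_reverse.2 hx.1.2
      simpa using this
    · rintro ⟨a, b, c, d, e⟩ - ⟨a', b', c', d', e'⟩ - h
      simp only [Prod.mk.injEq] at h ⊢
      tauto
  have hc3 : P₃.card ≤ K * n ^ 2 := by
    have hZc : Z.card ≤ 2 ^ h * (3 * t + 13) :=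
      (card_many_neighbors_le hfree hk H).trans (by gcongr; norm_num)
    rw [hP₃]
    simp only [Finset.card_product, Finset.card_univ, ← hnV]
    calc _ ≤ n * (h * ((2 ^ h * (3 * t + 13)) * (h * n))) := by gcongr
      _ = _ := by rw [hK]; ring
  have hc4 : q * P₄.card + n ^ 3 ≤ q * (t * (t - 1)) * n ^ 3 :=
    card_fivePaths_filter_core_le ht hq H hbad
  have hsum : G.fivePaths.card ≤ 2 * P₁.card + P₃.card + P₄.card := by
    have u0 := Finset.card_le_card hcover
    have u1 := Finset.card_union_le (P₁ ∪ P₂ ∪ P₃) P₄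
    have u2 := Finset.card_union_le (P₁ ∪ P₂) P₃
    have u3 := Finset.card_union_le P₁ P₂
    omega
  have hcube := cube_le_sub_cube_add n (t + 2)
  set τ := t * (t - 1) with hτ
  set m := (n - (t + 2)) ^ 3 with hm
  have e1 : q * M * (τ * m) ≤ q * M * (2 * P₁.card + P₃.card + P₄.card) :=
    Nat.mul_le_mul_left _ (hlow.trans hsum)
  have e2 : q * M * (2 * P₁.card + P₃.card + P₄.card) + M * n ^ 3 ≤
      2 * q * ((2 * k) ^ 2 * n ^ 3) + q * M * (K * n ^ 2) + M * (q * τ * n ^ 3) := by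
    calc _ = 2 * q * (M * P₁.card) + q * M * P₃.card + M * (q * P₄.card + n ^ 3) := by ring
      _ ≤ _ := by gcongr
  have e3 : q * M * τ * n ^ 3 ≤ q * M * τ * (m + 3 * (t + 2) * n ^ 2) := Nat.mul_le_mul_left _ hcube
  have e4 : n ^ 2 * n ≤ n ^ 2 * (q * M * (K + 3 * (t + 2) * τ)) := by
    have : M * n ^ 3 = 2 * q * ((2 * k) ^ 2 * n ^ 3) + n ^ 2 * n := by rw [hM]; ring
    rw [this] at e2
    have a1 : M * (q * τ * n ^ 3) = q * M * τ * n ^ 3 := by ring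
    have a2 : q * M * τ * (m + 3 * (t + 2) * n ^ 2) =
        q * M * (τ * m) + n ^ 2 * (q * M * (3 * (t + 2) * τ)) := by ring
    have a3 : n ^ 2 * (q * M * (K + 3 * (t + 2) * τ)) =
        q * M * (K * n ^ 2) + n ^ 2 * (q * M * (3 * (t + 2) * τ)) := by ring
    rw [a1] at e2
    rw [a2] at e3
    rw [a3]
    omega
  exact absurd (Nat.le_of_mul_le_mul_left e4 (by positivity)) (by omega)

end Stability

/-! ### The extremal graphs: path-freeness, path counts and essential edges -/

section Kopylov

open scoped Classical

lemma kopylovGraph_adj {n k a : ℕ} {i j : Fin n} : (kopylovGraph n k a).Adj i j ↔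
    i ≠ j ∧ (i.val < a ∨ j.val < a ∨ (i.val < k - a ∧ j.val < k - a)) := Iff.rfl

/-- Cut the path into `t + 1` disjoint consecutive pairs starting at position `s`. As `A` has `t`
vertices, some pair avoids `A` and is an edge inside `C`. This is impossible if `C` is a single
vertex. If `C` has two vertices, the shifts `s = 0` and `s = 1` give two different edges inside `C`,
again impossible. -/
lemma kopylovGraph_free {n k t : ℕ} (hk₁ : 2 * t + 1 ≤ k) (hk₂ : k ≤ 2 * t + 2) :
    (edgePath k).Free (kopylovGraph n k t) := by
  rintro ⟨f⟩
  have hinj : ∀ i j : Fin (k + 1), (f i).val = (f j).val → i.val = j.val := fun i j h =>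
    congrArg Fin.val (f.injective (Fin.ext h))
  have key : ∀ s, 2 * t + 1 + s ≤ k → ∃ i j : Fin (k + 1), i.val + 1 = j.val ∧
      i.val % 2 = s % 2 ∧ t ≤ (f i).val ∧ t ≤ (f j).val ∧ (f i).val < k - t ∧
      (f j).val < k - t := by
    intro s hs
    by_contra! hcon
    have hlow : ∀ m : Fin (t + 1), ∃ p : Fin (k + 1), (f p).val < t ∧
        (p.val = 2 * m.val + s ∨ p.val = 2 * m.val + s + 1) := by
      intro m
      have hm := m.isLt
      by_contra! hm'
      have h1 : t ≤ (f ⟨2 * m.val + s, by omega⟩).val := by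
        by_contra! h
        exact (hm' _ h).1 rfl
      have h2 : t ≤ (f ⟨2 * m.val + s + 1, by omega⟩).val := by
        by_contra! h
        exact (hm' _ h).2 rfl
      have hadj : (kopylovGraph n k t).Adj (f ⟨2 * m.val + s, by omega⟩)
          (f ⟨2 * m.val + s + 1, by omega⟩) :=
        f.toHom.map_adj (pathGraph_adj.2 (Or.inl rfl))
      have h3 := hcon ⟨2 * m.val + s, by omega⟩ ⟨2 * m.val + s + 1, by omega⟩ rfl
        (by simp only; omega) h1 h2
      have h4 := hadj.2
      omega
    choose p hp hpm using hlow
    have : Function.Injective fun m : Fin (t + 1) => (⟨(f (p m)).val, hp m⟩ : Fin t) := by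
      intro m m' h
      have h1 := hinj (p m) (p m') (congrArg (fun x : Fin t => x.val) h)
      have h2 := hpm m
      have h3 := hpm m'
      apply Fin.ext
      omega
    have := Fintype.card_le_of_injective _ this
    simp at this
  obtain ⟨i, j, hij, hi2, hi, hj, hi', hj'⟩ := key 0 (by omega)
  by_cases hk : k = 2 * t + 1
  · have := hinj i j (by omega)
    omega
  · obtain ⟨i₁, j₁, hij₁, hi2₁, hi₁, hj₁, hi₁', hj₁'⟩ := key 1 (by omega)
    have e1 := hinj i j
    have e2 := hinj i₁ j₁
    have e3 := hinj i i₁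
    have e4 := hinj j j₁
    have e5 := hinj i j₁
    have e6 := hinj j i₁
    omega

/-- The vertices of the class `A` of `kopylovGraph n k t`. -/
def kopylovCore (n t : ℕ) : Finset (Fin n) := Finset.univ.filter fun i => i.val < t

@[simp] lemma mem_kopylovCore {n t : ℕ} {i : Fin n} : i ∈ kopylovCore n t ↔ i.val < t := by
  simp [kopylovCore]

lemma card_kopylovCore {n t : ℕ} (h : t ≤ n) : (kopylovCore n t).card = t := by
  rw [kopylovCore, Fin.card_filter_val_lt, min_eq_right h]

/-- Put two vertices of `A` in the second and fourth places and any three distinct vertices outside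
`A` in the others. -/
lemma le_card_fivePaths_kopylovGraph {n k t : ℕ} (h : t + 2 ≤ n) :
    t * (t - 1) * (n - (t + 2)) ^ 3 ≤ (kopylovGraph n k t).fivePaths.card := by
  have h1 : ((kopylovCore n t).offDiag ×ˢ
      (Finset.univ : Finset (Fin 3 ↪ {x : Fin n // x ∉ kopylovCore n t}))).card ≤
      (kopylovGraph n k t).fivePaths.card := by
    refine Finset.card_le_card_of_injOn
      (fun p => (p.2 0, p.1.1, p.2 1, p.1.2, p.2 2)) ?_ ?_
    · rintro ⟨⟨a, a'⟩, g⟩ hp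
      simp only [Finset.mem_coe, Finset.mem_product, Finset.mem_offDiag, mem_kopylovCore,
        Finset.mem_univ, and_true] at hp
      obtain ⟨ha, ha', hne⟩ := hp
      have hg : ∀ i, ¬ ((g i : Fin n)).val < t := fun i => by simpa using (g i).2
      have hadj : ∀ (a : Fin n) i, a.val < t → (kopylovGraph n k t).Adj a (g i) := by
        intro a i ha
        exact ⟨fun h => hg i (h ▸ ha), Or.inl ha⟩
      have hgne : ∀ i j, i ≠ j → (g i : Fin n) ≠ g j := fun i j hij h =>
        hij (g.injective (Subtype.ext h))
      rw [Finset.mem_coe, mem_fivePaths]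
      refine ⟨⟨(hadj a 0 ha).symm, hadj a 1 ha, (hadj a' 1 ha').symm, hadj a' 2 ha'⟩, ?_⟩
      simp [(hadj a 0 ha).ne', (hadj a 1 ha).ne, (hadj a 2 ha).ne, (hadj a' 0 ha').ne',
        (hadj a' 1 ha').ne', (hadj a' 2 ha').ne, hne, hgne 0 1, hgne 0 2, hgne 1 2]
    · rintro ⟨⟨a, a'⟩, g⟩ - ⟨⟨b, b'⟩, g'⟩ - h
      simp only [Prod.mk.injEq] at h ⊢
      obtain ⟨h0, ha, h1, ha', h2⟩ := h
      refine ⟨⟨ha, ha'⟩, ?_⟩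
      ext i
      fin_cases i
      · exact congrArg Fin.val h0
      · exact congrArg Fin.val h1
      · exact congrArg Fin.val h2
  refine le_trans ?_ h1
  have h2 : Fintype.card {x : Fin n // x ∉ kopylovCore n t} = n - t := by
    rw [Fintype.card_subtype_compl, Fintype.card_fin, Fintype.card_coe,
      card_kopylovCore (by omega)]
  rw [Finset.card_product, Finset.offDiag_card, card_kopylovCore (by omega), Finset.card_univ,
    Fintype.card_embedding_eq, h2, Fintype.card_fin, Nat.mul_sub_one]
  refine Nat.mul_le_mul_left _ ?_
  have := Nat.pow_sub_le_descFactorial (n - t) 3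
  rwa [show n - t + 1 - 3 = n - (t + 2) by omega] at this

/-- Paths with second and fourth vertex in `A` give the main term. Otherwise one of these lies
outside `A`, so both its path neighbours lie in the bounded set `A ∪ C`; that vertex itself and the
oriented edge formed by the other two contribute `O(n)` each. -/
lemma card_fivePaths_kopylovGraph_le {n k t : ℕ} (hk₁ : 2 * t + 1 ≤ k) (hk₂ : k ≤ 2 * t + 2)
    (hn : k ≤ n) :
    (kopylovGraph n k t).fivePaths.card ≤ t * (t - 1) * n ^ 3 + 4 * k ^ 3 * n ^ 2 := by
  set G := kopylovGraph n k t with hG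
  set A := kopylovCore n t with hA
  set L := kopylovCore n (k - t) with hL
  have hd := card_dartsIn_le (kopylovGraph_free (n := n) hk₁ hk₂) Finset.univ
  rw [Finset.card_univ, Fintype.card_fin, ← hG] at hd
  have hAc : A.card = t := card_kopylovCore (by omega)
  have hLc : L.card ≤ k := by
    rw [hL, card_kopylovCore (by omega)]
    omega
  have hlow : ∀ u v, G.Adj u v → u ∉ A → v ∈ L := by
    intro u v huv hu
    have := huv.2
    simp only [hA, hL, mem_kopylovCore] at hu ⊢
    omega
  set P₁ : Finset (Fin n × Fin n × Fin n × Fin n × Fin n) :=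
    (A.offDiag ×ˢ (Finset.univ ×ˢ (Finset.univ ×ˢ Finset.univ))).image
      (fun p => (p.2.1, p.1.1, p.2.2.1, p.1.2, p.2.2.2)) with hP₁
  set S : Finset ((Fin n × Fin n) × Fin n × Fin n × Fin n) :=
    G.dartsIn Finset.univ ×ˢ (L ×ˢ (Finset.univ ×ˢ L)) with hS
  set P₂ : Finset (Fin n × Fin n × Fin n × Fin n × Fin n) :=
    S.image (fun p => (p.2.1, p.2.2.1, p.2.2.2, p.1.1, p.1.2)) with hP₂
  set P₃ : Finset (Fin n × Fin n × Fin n × Fin n × Fin n) :=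
    S.image (fun p => (p.1.1, p.1.2, p.2.1, p.2.2.1, p.2.2.2)) with hP₃
  have hcover : G.fivePaths ⊆ P₁ ∪ P₂ ∪ P₃ := by
    rintro ⟨a, b, c, d, e⟩ hx
    rw [mem_fivePaths] at hx
    obtain ⟨⟨e1, e2, e3, e4⟩, hnd⟩ := hx
    by_cases hb : b ∈ A
    · by_cases hd : d ∈ A
      · refine Finset.mem_union_left _ (Finset.mem_union_left _ (Finset.mem_image.2
          ⟨((b, d), a, c, e), ?_, rfl⟩))
        have hbd : b ≠ d := by
          rintro rfl
          simp at hnd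
        simp [hb, hd, hbd]
      · refine Finset.mem_union_right _ (Finset.mem_image.2 ⟨((a, b), c, d, e), ?_, rfl⟩)
        simp [hS, e1, hlow _ _ e3.symm hd, hlow _ _ e4 hd]
    · refine Finset.mem_union_left _ (Finset.mem_union_right _ (Finset.mem_image.2
        ⟨((d, e), a, b, c), ?_, rfl⟩))
      simp [hS, e4, hlow _ _ e1.symm hb, hlow _ _ e2 hb]
  have hc1 : P₁.card ≤ t * (t - 1) * n ^ 3 := by
    refine Finset.card_image_le.trans_eq ?_
    simp only [Finset.card_product, Finset.offDiag_card, hAc, Finset.card_univ, Fintype.card_fin,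
      Nat.mul_sub_one]
    ring
  have hSc : S.card ≤ 2 * k ^ 3 * n ^ 2 := by
    rw [hS]
    simp only [Finset.card_product, Finset.card_univ, Fintype.card_fin]
    calc _ ≤ 2 * k * n * (k * (n * k)) := by gcongr
      _ = _ := by ring
  have hc2 : P₂.card ≤ S.card := Finset.card_image_le
  have hc3 : P₃.card ≤ S.card := Finset.card_image_le
  have u0 := Finset.card_le_card hcover
  have u1 := Finset.card_union_le (P₁ ∪ P₂) P₃
  have u2 := Finset.card_union_le P₁ P₂
  have u3 : 4 * k ^ 3 * n ^ 2 = 2 * k ^ 3 * n ^ 2 + 2 * k ^ 3 * n ^ 2 := by ring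
  omega

/-- A subgraph of `kopylovGraph n k t` with the same number of four-edge paths contains every edge,
except possibly the edge inside the class `A` if `k = 5`. -/
lemma adj_of_card_fivePaths_eq_kopylovGraph {n k t : ℕ} (hk₁ : 2 * t + 1 ≤ k)
    (hk₂ : k ≤ 2 * t + 2) (ht : 2 ≤ t) (hn : k + 10 ≤ n) {G : SimpleGraph (Fin n)}
    (hle : G ≤ kopylovGraph n k t)
    (hcard : (kopylovGraph n k t).fivePaths.card ≤ G.fivePaths.card) {i j : Fin n}
    (hij : (kopylovGraph n k t).Adj i j) (hk : ¬ (k = 5 ∧ i.val < t ∧ j.val < t)) :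
    G.Adj i j := by
  -- The two path sets coincide, so it suffices to place each required edge on some four-edge path
  -- of `kopylovGraph`.
  have heq : G.fivePaths = (kopylovGraph n k t).fivePaths :=
    Finset.eq_of_subset_of_card_le (fivePaths_mono hle) hcard
  have hmixed : ∀ i j : Fin n, i.val < t → t ≤ j.val → G.Adj i j := by
    intro i j hi hj
    obtain ⟨a, ha, hai⟩ : ∃ a : Fin n, a.val < t ∧ a ≠ i := by
      by_cases h0 : i.val = 0
      · exact ⟨⟨1, by omega⟩, by simp only; omega, fun h => by simp [← h] at h0⟩
      · exact ⟨⟨0, by omega⟩, by simp only; omega, fun h => by simp [← h] at h0⟩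
    obtain ⟨b, hb, hbj⟩ : ∃ b : Fin n, (b.val = n - 1 ∨ b.val = n - 2) ∧ b.val ≠ j.val := by
      by_cases h0 : j.val = n - 1
      · exact ⟨⟨n - 2, by omega⟩, by simp, by simp only; omega⟩
      · exact ⟨⟨n - 1, by omega⟩, by simp, by simp only; omega⟩
    obtain ⟨c, hc, hcj⟩ : ∃ c : Fin n, (c.val = n - 3 ∨ c.val = n - 4) ∧ c.val ≠ j.val := by
      by_cases h0 : j.val = n - 3
      · exact ⟨⟨n - 4, by omega⟩, by simp, by simp only; omega⟩
      · exact ⟨⟨n - 3, by omega⟩, by simp, by simp only; omega⟩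
    have : (j, i, b, a, c) ∈ G.fivePaths := by
      rw [heq, mem_fivePaths]
      simp only [kopylovGraph_adj, List.nodup_cons, List.mem_cons, List.not_mem_nil, or_false,
        not_or, Fin.ext_iff, ne_eq, not_false_eq_true, List.nodup_nil, and_true] at *
      omega
    exact (mem_fivePaths.1 this).1.1.symm
  by_cases hi : i.val < t
  · by_cases hj : j.val < t
    · by_cases ht3 : 3 ≤ t
      · obtain ⟨a, ha, hai, haj⟩ : ∃ a : Fin n, a.val < t ∧ a.val ≠ i.val ∧ a.val ≠ j.val := by
          by_cases h0 : i.val ≠ 0 ∧ j.val ≠ 0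
          · exact ⟨⟨0, by omega⟩, by simp only; omega, by simp only; omega, by simp only; omega⟩
          · by_cases h1 : i.val ≠ 1 ∧ j.val ≠ 1
            · exact ⟨⟨1, by omega⟩, by simp only; omega, by simp only; omega, by simp only; omega⟩
            · exact ⟨⟨2, by omega⟩, by simp only; omega, by simp only; omega, by simp only; omega⟩
        have : ((⟨n - 1, by omega⟩, i, j, ⟨n - 2, by omega⟩, a) :
            Fin n × Fin n × Fin n × Fin n × Fin n) ∈ G.fivePaths := by
          rw [heq, mem_fivePaths]
          simp only [kopylovGraph_adj, List.nodup_cons, List.mem_cons, List.not_mem_nil, or_false,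
            not_or, Fin.ext_iff, ne_eq, not_false_eq_true, List.nodup_nil, and_true] at *
          omega
        exact (mem_fivePaths.1 this).1.2.1
      -- Here `t = 2` and `k = 6`: the path enters `A` from the edge inside `C`, which does not
      -- exist when `k = 5`.
      · have : ((⟨t, by omega⟩, ⟨t + 1, by omega⟩, i, j, ⟨n - 1, by omega⟩) :
            Fin n × Fin n × Fin n × Fin n × Fin n) ∈ G.fivePaths := by
          rw [heq, mem_fivePaths]
          simp only [kopylovGraph_adj, List.nodup_cons, List.mem_cons, List.not_mem_nil, or_false,
            not_or, Fin.ext_iff, ne_eq, not_false_eq_true, List.nodup_nil, and_true] at *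
          omega
        exact (mem_fivePaths.1 this).1.2.2.1
    · exact hmixed i j hi (by omega)
  · by_cases hj : j.val < t
    · exact (hmixed j i hj (by omega)).symm
    · have : ((i, j, ⟨0, by omega⟩, ⟨n - 1, by omega⟩, ⟨1, by omega⟩) :
          Fin n × Fin n × Fin n × Fin n × Fin n) ∈ G.fivePaths := by
        rw [heq, mem_fivePaths]
        simp only [kopylovGraph_adj, List.nodup_cons, List.mem_cons, List.not_mem_nil, or_false,
          not_or, Fin.ext_iff, ne_eq, not_false_eq_true, List.nodup_nil, and_true] at *
        omega
      exact (mem_fivePaths.1 this).1.1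

/-- The complete bipartite graph with classes `{i | i < 2}` and `{i | 2 ≤ i}`. -/
def bipartiteTwo (n : ℕ) : SimpleGraph (Fin n) where
  Adj i j := (i.val < 2 ∧ 2 ≤ j.val) ∨ (j.val < 2 ∧ 2 ≤ i.val)
  symm := ⟨fun _ _ h => h.symm⟩
  loopless := ⟨fun _ h => by omega⟩

lemma bipartiteTwo_adj {n : ℕ} {i j : Fin n} : (bipartiteTwo n).Adj i j ↔
    (i.val < 2 ∧ 2 ≤ j.val) ∨ (j.val < 2 ∧ 2 ≤ i.val) := Iff.rfl

lemma bipartiteTwo_le (n k : ℕ) : bipartiteTwo n ≤ kopylovGraph n k 2 := by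
  intro i j h
  rw [bipartiteTwo_adj] at h
  rw [kopylovGraph_adj, ne_eq, Fin.ext_iff]
  omega

/-- The standard isomorphism from the complete bipartite graph on `2 + (n - 2)` vertices. -/
def bipartiteTwoIso {n : ℕ} (h : 2 ≤ n) :
    completeBipartiteGraph (Fin 2) (Fin (n - 2)) ≃g bipartiteTwo n where
  toEquiv := finSumFinEquiv.trans (finCongr (by omega))
  map_rel_iff' := by
    rintro (a | a) (b | b) <;> simp [bipartiteTwo_adj] <;> omega

/-- For `k = 5` the class `C` is one vertex, so the complement of `A` is independent. With `#A = 2`,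
a four-edge path must have exactly its second and fourth vertices in `A` and never uses the edge
inside `A`. -/
lemma fivePaths_bipartiteTwo (n : ℕ) :
    (bipartiteTwo n).fivePaths = (kopylovGraph n 5 2).fivePaths := by
  refine Finset.Subset.antisymm (fivePaths_mono (bipartiteTwo_le n 5)) ?_
  rintro ⟨a, b, c, d, e⟩ hx
  rw [mem_fivePaths] at hx ⊢
  refine ⟨?_, hx.2⟩
  simp only [kopylovGraph_adj, List.nodup_cons, List.mem_cons, List.not_mem_nil, or_false,
    not_or, Fin.ext_iff, ne_eq, not_false_eq_true, List.nodup_nil, and_true] at hx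
  simp only [bipartiteTwo_adj]
  obtain ⟨⟨⟨-, e1⟩, ⟨-, e2⟩, ⟨-, e3⟩, -, e4⟩, ⟨nab, nac, nad, nae⟩, ⟨nbc, nbd, nbe⟩,
    ⟨ncd, nce⟩, nde⟩ := hx
  have hb : b.val < 2 := by omega
  have hd : d.val < 2 := by omega
  omega

end Kopylov

/-! ### From the structure to a subgraph of the extremal graph -/

section Extremal

open scoped Classical

lemma isGenExtremal_iff {n k : ℕ} {G : SimpleGraph (Fin n)} :
    IsGenExtremal (edgePath 4) (edgePath k) G ↔ (edgePath k).Free G ∧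
      ∀ G' : SimpleGraph (Fin n), (edgePath k).Free G' → G'.fivePaths.card ≤ G.fivePaths.card := by
  simp only [card_fivePaths]
  refine and_congr_right fun hfree => ⟨fun h G' hG' => ?_, fun h => ?_⟩
  · rw [h]
    refine Nat.mul_le_mul_left 2 ?_
    exact Finset.le_sup (f := fun G : SimpleGraph (Fin n) => G.copyCount (edgePath 4))
      (Finset.mem_filter.2 ⟨Finset.mem_univ _, hG'⟩)
  · refine le_antisymm ?_ (Finset.sup_le fun G' hG' => ?_)
    · exact Finset.le_sup (f := fun G : SimpleGraph (Fin n) => G.copyCount (edgePath 4))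
        (Finset.mem_filter.2 ⟨Finset.mem_univ _, hfree⟩)
    · have := h G' (Finset.mem_filter.1 hG').2
      omega

lemma exists_isGenExtremal {n k : ℕ} {G : SimpleGraph (Fin n)} (h : (edgePath k).Free G) :
    ∃ G' : SimpleGraph (Fin n), IsGenExtremal (edgePath 4) (edgePath k) G' := by
  obtain ⟨G', hG', heq⟩ := Finset.exists_mem_eq_sup
    (Finset.univ.filter fun G : SimpleGraph (Fin n) => (edgePath k).Free G)
    ⟨G, Finset.mem_filter.2 ⟨Finset.mem_univ _, h⟩⟩ (fun G => G.copyCount (edgePath 4))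
  exact ⟨G', (Finset.mem_filter.1 hG').2, heq.symm⟩

lemma exists_perm_core {n t : ℕ} {A : Finset (Fin n)} (hA : A.card = t) (ht : t ≤ n) :
    ∃ σ : Equiv.Perm (Fin n), ∀ v, v ∈ A ↔ (σ v).val < t := by
  have e : {x // x ∈ A} ≃ {x : Fin n // x.val < t} := by
    refine Fintype.equivOfCardEq ?_
    rw [Fintype.card_coe, hA, Fintype.card_subtype]
    exact (card_kopylovCore ht).symm
  refine ⟨e.extendSubtype, fun v => ⟨fun h => e.extendSubtype_mem v h, fun h => ?_⟩⟩
  by_contra hv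
  exact e.extendSubtype_not_mem v hv h

/-- A graph with at most one edge outside a set of `t` vertices is isomorphic to a subgraph of
`kopylovGraph`. -/
lemma exists_iso_le_kopylovGraph {n k t : ℕ} {G : SimpleGraph (Fin n)} {A : Finset (Fin n)}
    (hA : A.card = t) (hn : t + 2 ≤ n)
    (hedge : ∀ x y, x ∉ A → y ∉ A → G.Adj x y → k = 2 * t + 2 ∧
      ∀ z w, z ∉ A → w ∉ A → G.Adj z w → (z = x ∧ w = y) ∨ (z = y ∧ w = x)) :
    ∃ H : SimpleGraph (Fin n), Nonempty (G ≃g H) ∧ H ≤ kopylovGraph n k t := by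
  obtain ⟨σ, hσ⟩ := exists_perm_core hA (by omega : t ≤ n)
  suffices h : ∃ τ : Equiv.Perm (Fin n), (∀ v, v ∈ A ↔ (τ v).val < t) ∧
      ∀ x y, x ∉ A → y ∉ A → G.Adj x y → (τ x).val < k - t ∧ (τ y).val < k - t by
    obtain ⟨τ, hτ, hτe⟩ := h
    refine ⟨G.map τ, ⟨Iso.map τ G⟩, ?_⟩
    rintro _ _ ⟨-, u, v, huv, rfl, rfl⟩
    refine ⟨fun h => huv.ne (τ.injective h), ?_⟩
    rw [← hτ, ← hτ]
    by_cases hu : u ∈ A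
    · exact Or.inl hu
    · by_cases hv : v ∈ A
      · exact Or.inr (Or.inl hv)
      · exact Or.inr (Or.inr (hτe u v hu hv huv))
  by_cases hex : ∃ x y, x ∉ A ∧ y ∉ A ∧ G.Adj x y
  · obtain ⟨x, y, hx, hy, hxy⟩ := hex
    obtain ⟨hk, huniq⟩ := hedge x y hx hy hxy
    set p : Fin n := ⟨t, by omega⟩ with hp
    set q : Fin n := ⟨t + 1, by omega⟩ with hq
    have hpq : p ≠ q := fun h => by simp [hp, hq] at h
    have hswap : ∀ a b v : Fin n, t ≤ a.val → t ≤ b.val →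
        ((Equiv.swap a b v).val < t ↔ v.val < t) := by
      intro a b v ha hb
      rw [Equiv.swap_apply_def]
      split_ifs with h1 h2
      · subst h1; omega
      · subst h2; omega
      · rfl
    -- After `σ` sends `A` to the first `t` indices, two swaps among the remaining indices bring `x`
    -- and `y` to `t` and `t + 1`, the two places of `C`.
    set y' := Equiv.swap (σ x) p (σ y) with hy'
    have hσx : t ≤ (σ x).val := not_lt.1 fun h => hx ((hσ x).2 h)
    have hσy : t ≤ (σ y).val := not_lt.1 fun h => hy ((hσ y).2 h)
    have hy't : t ≤ y'.val := not_lt.1 fun h => by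
      rw [hy', hswap _ _ _ hσx le_rfl] at h
      omega
    have hy'p : p ≠ y' := by
      intro h
      have h1 : Equiv.swap (σ x) p (σ x) = Equiv.swap (σ x) p (σ y) := by
        rw [Equiv.swap_apply_left]; exact h
      exact hxy.ne (σ.injective ((Equiv.swap (σ x) p).injective h1))
    refine ⟨(σ.trans (Equiv.swap (σ x) p)).trans (Equiv.swap y' q), fun v => ?_, ?_⟩
    · simp only [Equiv.trans_apply]
      rw [hswap _ _ _ hy't (by simp [hq]), hswap _ _ _ hσx (by simp [hp])]
      exact hσ v
    · have h1 : ((σ.trans (Equiv.swap (σ x) p)).trans (Equiv.swap y' q)) x = p := by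
        simp only [Equiv.trans_apply, Equiv.swap_apply_left]
        exact Equiv.swap_apply_of_ne_of_ne hy'p hpq
      have h2 : ((σ.trans (Equiv.swap (σ x) p)).trans (Equiv.swap y' q)) y = q := by
        simp only [Equiv.trans_apply]
        rw [← hy', Equiv.swap_apply_left]
      intro z w hz hw hzw
      rcases huniq z w hz hw hzw with ⟨rfl, rfl⟩ | ⟨rfl, rfl⟩ <;> rw [h1, h2] <;>
        simp only [hp, hq] <;> omega
  · refine ⟨σ, hσ, fun x y hx hy hxy => absurd ⟨x, y, hx, hy, hxy⟩ hex⟩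

/-- For large `n`, every graph with the maximum number of four-edge paths is isomorphic to a
subgraph of `kopylovGraph`. -/
theorem exists_iso_le_kopylovGraph_of_isGenExtremal (k t : ℕ) (ht : 2 ≤ t) (hk₁ : 2 * t + 1 ≤ k)
    (hk₂ : k ≤ 2 * t + 2) : ∃ n₁ : ℕ, k + 10 ≤ n₁ ∧ ∀ n, n₁ ≤ n → ∀ G : SimpleGraph (Fin n),
      IsGenExtremal (edgePath 4) (edgePath k) G →
      ∃ H : SimpleGraph (Fin n), Nonempty (G ≃g H) ∧ H ≤ kopylovGraph n k t := by
  -- With `q = 8 * k * t` each of the `t` core vertices misses at most `n / (8 * k * t)` vertices,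
  -- so `B` misses at most `n / (8 * k)`. The loss bound `(2 * k * (n - #B)) ^ 2` is then at most `n
  -- ^ 2 / 16`, against a gain of about `n ^ 2 / 4` or more.
  obtain ⟨n₀, hcore⟩ := exists_core_of_card_fivePaths k t (8 * k * t) ht hk₂
    (Nat.mul_pos (by omega) (by omega))
  refine ⟨n₀ + 32 * k * t + 8 * k + 6 * t + 100, by omega, fun n hn G hG => ?_⟩
  have hkt : 0 < k * t := Nat.mul_pos (by omega) (by omega)
  have hn' : n₀ + 32 * (k * t) + 8 * k + 6 * t + 100 ≤ n := by rw [← mul_assoc]; exact hn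
  rw [isGenExtremal_iff] at hG
  obtain ⟨hfree, hmax⟩ := hG
  have hcard : t * (t - 1) * (Fintype.card (Fin n) - (t + 2)) ^ 3 ≤ G.fivePaths.card := by
    rw [Fintype.card_fin]
    exact (le_card_fivePaths_kopylovGraph (by omega)).trans (hmax _ (kopylovGraph_free hk₁ hk₂))
  obtain ⟨A, hA, hdeg⟩ := hcore (Fin n) G (by rw [Fintype.card_fin]; omega) hfree hcard
  rw [Fintype.card_fin] at hdeg
  set B : Finset (Fin n) := Finset.univ.filter fun b => ∀ a ∈ A, G.Adj a b with hB
  have hAB : ∀ a ∈ A, ∀ b ∈ B, G.Adj a b := fun a ha b hb => (Finset.mem_filter.1 hb).2 a ha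
  have hBn : B.card ≤ n := by simpa using Finset.card_le_univ B
  have hBc : 8 * k * (n - B.card) ≤ n := by
    have h1 : Bᶜ.card ≤ ∑ a ∈ A, (G.neighborsIn Finset.univ a)ᶜ.card := by
      refine (Finset.card_le_card ?_).trans Finset.card_biUnion_le
      intro b hb
      simpa [hB] using hb
    rw [Finset.card_compl, Fintype.card_fin] at h1
    have h2 : ∀ a ∈ A, 8 * k * t * (G.neighborsIn Finset.univ a)ᶜ.card ≤ n := by
      intro a ha
      have h3 := hdeg a ha
      have h4 : (G.neighborsIn Finset.univ a).card + (G.neighborsIn Finset.univ a)ᶜ.card = n := by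
        rw [Finset.card_add_card_compl, Fintype.card_fin]
      have h5 : 8 * k * t * n = 8 * k * t * (G.neighborsIn Finset.univ a).card +
          8 * k * t * (G.neighborsIn Finset.univ a)ᶜ.card := by
        rw [← mul_add, h4]
      omega
    have h6 : t * (8 * k * (n - B.card)) ≤ t * n := by
      calc _ = 8 * k * t * (n - B.card) := by ring
        _ ≤ 8 * k * t * ∑ a ∈ A, (G.neighborsIn Finset.univ a)ᶜ.card := by gcongr
        _ = ∑ a ∈ A, 8 * k * t * (G.neighborsIn Finset.univ a)ᶜ.card := by rw [Finset.mul_sum]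
        _ ≤ A.card * n := by simpa using Finset.sum_le_card_nsmul A _ n h2
        _ = t * n := by rw [hA]
    exact Nat.le_of_mul_le_mul_left h6 (by omega)
  have hhalf : n ≤ 2 * B.card := by
    have : n - B.card ≤ k * (n - B.card) := Nat.le_mul_of_pos_left _ (by omega)
    have h8 : 8 * k * (n - B.card) = 8 * (k * (n - B.card)) := by ring
    omega
  have hquarter : n * n ≤ 4 * (B.card * B.card) := by
    calc n * n ≤ (2 * B.card) * (2 * B.card) := Nat.mul_le_mul hhalf hhalf
      _ = _ := by ring
  refine exists_iso_le_kopylovGraph hA (by omega) fun x y hx hy hxy => ?_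
  have hres := edges_of_maximal hfree hmax hAB (by omega) (by omega) (by omega) (by omega) ?_ ?_
    hx hy hxy
  · rwa [hA] at hres
  · rw [Fintype.card_fin]
    have h1 : 16 * (2 * k * (n - B.card)) ^ 2 ≤ n * n := by
      calc _ = (8 * k * (n - B.card)) * (8 * k * (n - B.card)) := by ring
        _ ≤ n * n := Nat.mul_le_mul hBc hBc
    have h2 : 100 * n ≤ n * n := Nat.mul_le_mul_right _ (by omega)
    omega
  · rw [Fintype.card_fin, hA]
    have h2 : (32 * (k * t) + 100) * n ≤ n * n := Nat.mul_le_mul_right _ (by omega)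
    have h3 : (32 * (k * t) + 100) * n = 4 * (8 * k * t * n) + 100 * n := by ring
    omega

end Extremal

end SimpleGraph

/-! ### The main theorem -/

open SimpleGraph in
theorem theorem4p6 (k : ℕ) (hk : 5 ≤ k) (t : ℕ) (ht : t = (k - 1) / 2) :
    (∃ n₁ : ℕ, ∀ n : ℕ, n₁ ≤ n →
      genExtremalNumber n (edgePath 4) (edgePath k)
          = (kopylovGraph n k t).copyCount (edgePath 4) ∧
      ∀ G : SimpleGraph (Fin n),
        IsGenExtremal (edgePath 4) (edgePath k) G ↔
          (Nonempty (G ≃g kopylovGraph n k t) ∨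
            (k = 5 ∧ Nonempty (G ≃g completeBipartiteGraph (Fin 2) (Fin (n - 2)))))) ∧
    (fun n : ℕ => (genExtremalNumber n (edgePath 4) (edgePath k) : ℝ)
        - (t : ℝ) * ((t : ℝ) - 1) / 2 * (n : ℝ) ^ 3)
      =O[atTop] (fun n : ℕ => (n : ℝ) ^ 2) := by
  have ht2 : 2 ≤ t := by omega
  have hk₁ : 2 * t + 1 ≤ k := by omega
  have hk₂ : k ≤ 2 * t + 2 := by omega
  obtain ⟨n₁, hn₁, hstruct⟩ := exists_iso_le_kopylovGraph_of_isGenExtremal k t ht2 hk₁ hk₂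
  -- Some extremal graph exists by finiteness and embeds in `kopylovGraph`, which is itself
  -- `P_k`-free and hence also extremal.
  have hkop : ∀ n, n₁ ≤ n → IsGenExtremal (edgePath 4) (edgePath k) (kopylovGraph n k t) := by
    intro n hn
    obtain ⟨G, hG⟩ := exists_isGenExtremal (kopylovGraph_free (n := n) hk₁ hk₂)
    obtain ⟨H, ⟨φ⟩, hH⟩ := hstruct n hn G hG
    rw [isGenExtremal_iff] at hG ⊢
    refine ⟨kopylovGraph_free hk₁ hk₂, fun G' hG' => ?_⟩
    rw [card_fivePaths_congr φ] at hG
    exact (hG.2 G' hG').trans (Finset.card_le_card (fivePaths_mono hH))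
  refine ⟨⟨n₁, fun n hn => ⟨(hkop n hn).2.symm, fun G => ⟨fun hG => ?_, ?_⟩⟩⟩, ?_⟩
  · obtain ⟨H, ⟨φ⟩, hH⟩ := hstruct n hn G hG
    have hcard : (kopylovGraph n k t).fivePaths.card ≤ H.fivePaths.card := by
      rw [← card_fivePaths_congr φ]
      exact (isGenExtremal_iff.1 hG).2 _ (kopylovGraph_free hk₁ hk₂)
    have hadj : ∀ i j, (kopylovGraph n k t).Adj i j → ¬ (k = 5 ∧ i.val < t ∧ j.val < t) →
        H.Adj i j := fun i j =>
      adj_of_card_fivePaths_eq_kopylovGraph hk₁ hk₂ ht2 (by omega) hH hcard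
    obtain ⟨z, hz⟩ : ∃ z : Fin n, z.val = 0 := ⟨⟨0, by omega⟩, rfl⟩
    obtain ⟨w, hw⟩ : ∃ w : Fin n, w.val = 1 := ⟨⟨1, by omega⟩, rfl⟩
    -- The vertices `z` and `w` form `A` when `k = 5`; their edge is the only one that `H` may lack.
    by_cases hin : k = 5 ∧ ¬ H.Adj z w
    · obtain ⟨rfl, hin⟩ := hin
      obtain rfl : t = 2 := by omega
      refine Or.inr ⟨rfl, ?_⟩
      have hHeq : H = bipartiteTwo n := by
        ext i j
        rw [bipartiteTwo_adj]
        constructor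
        · intro hij
          have h1 := hH hij
          rw [kopylovGraph_adj] at h1
          by_contra hcon
          have hne : i.val ≠ j.val := fun h => h1.1 (Fin.ext h)
          have hcases : (i.val = 0 ∧ j.val = 1) ∨ (i.val = 1 ∧ j.val = 0) := by omega
          rcases hcases with ⟨hi, hj⟩ | ⟨hi, hj⟩
          · rw [show i = z from Fin.ext (hi.trans hz.symm),
              show j = w from Fin.ext (hj.trans hw.symm)] at hij
            exact hin hij
          · rw [show i = w from Fin.ext (hi.trans hw.symm),
              show j = z from Fin.ext (hj.trans hz.symm)] at hij
            exact hin hij.symm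
        · intro hij
          exact hadj i j (bipartiteTwo_le n 5 (bipartiteTwo_adj.2 hij)) (by omega)
      subst hHeq
      exact ⟨φ.trans (bipartiteTwoIso (by omega)).symm⟩
    · left
      have hHeq : H = kopylovGraph n k t := by
        refine le_antisymm hH fun i j hij => ?_
        by_cases h5 : k = 5 ∧ i.val < t ∧ j.val < t
        · have hH01 : H.Adj z w := by
            by_contra h
            exact hin ⟨h5.1, h⟩
          have hne : i.val ≠ j.val := fun h => hij.1 (Fin.ext h)
          have hcases : (i.val = 0 ∧ j.val = 1) ∨ (i.val = 1 ∧ j.val = 0) := by omega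
          rcases hcases with ⟨hi, hj⟩ | ⟨hi, hj⟩
          · rwa [show i = z from Fin.ext (hi.trans hz.symm),
              show j = w from Fin.ext (hj.trans hw.symm)]
          · rw [show i = w from Fin.ext (hi.trans hw.symm),
              show j = z from Fin.ext (hj.trans hz.symm)]
            exact hH01.symm
        · exact hadj i j hij h5
      exact hHeq ▸ ⟨φ⟩
  · have hmaxk := isGenExtremal_iff.1 (hkop n hn)
    rintro (⟨⟨φ⟩⟩ | ⟨rfl, ⟨φ⟩⟩)
    · rw [isGenExtremal_iff, free_congr_right φ, card_fivePaths_congr φ]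
      exact hmaxk
    · obtain rfl : t = 2 := by omega
      have ψ := φ.trans (bipartiteTwoIso (by omega))
      rw [isGenExtremal_iff, free_congr_right ψ, card_fivePaths_congr ψ, fivePaths_bipartiteTwo]
      exact ⟨fun h => hmaxk.1 (h.mono_right (bipartiteTwo_le n 5)), hmaxk.2⟩
  -- The constant adds the lower-order losses of both counting bounds; the lower one comes from
  -- replacing `(n - (t + 2)) ^ 3` by `n ^ 3`. The counts are of labelled paths, so half of it would
  -- do.
  · refine IsBigO.of_bound ((t : ℝ) * (t - 1) * (3 * (t + 2)) + 4 * k ^ 3) ?_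
    filter_upwards [eventually_ge_atTop n₁] with n hn
    have hlow := le_card_fivePaths_kopylovGraph (n := n) (k := k) (t := t) (by omega)
    have hup := card_fivePaths_kopylovGraph_le (n := n) hk₁ hk₂ (by omega)
    have hval : (kopylovGraph n k t).fivePaths.card =
        2 * genExtremalNumber n (edgePath 4) (edgePath k) := by
      rw [card_fivePaths, (hkop n hn).2]
    rw [hval] at hlow hup
    have hcube := Nat.mul_le_mul_left (t * (t - 1)) (cube_le_sub_cube_add n (t + 2))
    have hlow' : t * (t - 1) * n ^ 3 ≤ 2 * genExtremalNumber n (edgePath 4) (edgePath k) +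
        t * (t - 1) * (3 * (t + 2) * n ^ 2) := by
      rw [mul_add] at hcube
      omega
    have hcast : ((t - 1 : ℕ) : ℝ) = (t : ℝ) - 1 := by
      rw [Nat.cast_sub (by omega), Nat.cast_one]
    have h1 : (t : ℝ) * (t - 1) * n ^ 3 ≤ 2 * genExtremalNumber n (edgePath 4) (edgePath k) +
        t * (t - 1) * (3 * (t + 2) * n ^ 2) := by
      rw [← hcast]; exact_mod_cast hlow'
    have h2 : (2 : ℝ) * genExtremalNumber n (edgePath 4) (edgePath k) ≤
        t * (t - 1) * n ^ 3 + 4 * k ^ 3 * n ^ 2 := by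
      rw [← hcast]; exact_mod_cast hup
    have hnonneg : (0 : ℝ) ≤ t * (t - 1) * (3 * (t + 2) * n ^ 2) := by
      rw [← hcast]; positivity
    have hnonneg' : (0 : ℝ) ≤ 4 * k ^ 3 * n ^ 2 := by positivity
    rw [Real.norm_eq_abs, Real.norm_eq_abs, abs_of_nonneg (by positivity : (0 : ℝ) ≤ (n : ℝ) ^ 2),
      abs_le]
    constructor <;> linarith
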